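/- A partition is identified with its Young diagram, a finite set of squares $(i,j)$ (row $i\ge 0$, column $j\ge 0$). A skew semistandard tableau of shape $\lambda/\mu$ (a pair of partitions with $\mu\subseteq\lambda$) is a filling of the squares of $\lambda$ not in $\mu$ with entries in $\mathbb{N}=\{0,1,2,\dots\}$ that weakly increase from left to right along rows and strictly increase from top to bottom down columns. It is a semistandard Young tableau if $\mu=0$ is the empty partition, and a Littlewood–Richardson tableau if, reading its entries row by row from top to bottom and each row from right to left, every initial part of the resulting word contains at least as many letters $i$ as letters $i+1$, for every $i\in\mathbb{N}$. An inward jeu de taquin slide applies to a tableau of shape $\lambda/\mu$ and a corner $c$ of $\mu$: starting with $c$ as empty square, one repeatedly moves into the empty square the smaller of the entries directly to its right and directly below it (the one below in case of a tie; the only one present if there is just one), until the empty square $d$ has no square of $\lambda$ directly to its right or below; the result has shape $(\lambda\setminus\{d\})/(\mu\setminus\{c\})$. For a word $w'=u\,(i+1)\,v$ in the alphabet $\mathbb{N}$ such that every suffix of $u$ has at least as many letters $i+1$ as letters $i$, and every prefix of $v$ has at least as many letters $i$ as letters $i+1$, one sets $e_i(w')=u\,i\,v$; for a given $i$, $e_i(w')$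 is undefined if $w'$ has no such decomposition. A valid reading order on a skew diagram is a total order on its squares in which $(i,j)$ precedes or equals $(i',j')$ whenever $i\le i'$ and $j\ge j'$. The raising operation $e_i$ (for $i\in\mathbb{N}$) replaces a skew semistandard tableau $T$ by the skew semistandard tableau of the same shape whose reading word, for some valid reading order, is obtained by applying $e_i$ to the reading word of $T$ for that order (the choice of the order is known to be immaterial). **Statement.** On the set of all skew semistandard tableaux, the two rewrite systems defined by inward jeu de taquin slides, respectively by the raising operations $e_i$ ($i\in\mathbb{N}$), are both confluent: whenever $U$ and $V$ can both be reached from $T$ by finitely many (possibly zero) steps, there is a tableau reachable from both $U$ and $V$. The tableaux to which no inward slide applies are exactly the semistandard Young tableaux, and the tableaux to which no raising operation applies are exactly the Littlewood–Richardson tableaux. Every skew semistandard tableau $T$ has exactly one normal form for each of the two systems (a tableau reachable from $T$ to which no further step applies). Moreover the two normal forms of $T$ uniquely determine $T$: if $T_1$ and $T_2$ have the same normal form for inward slides and the same normal form for raising operations, then $T_1=T_2$. -/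

import Mathlib

/-! ### Rewrite systems -/

/-- A rewrite system (a relation `r a b`, "`a` rewrites to `b` in one step") is confluent if any two
objects reachable from a common one have a common descendant. -/
def Confluent {α : Type*} (r : α → α → Prop) : Prop :=
  ∀ a b c : α, Relation.ReflTransGen r a b → Relation.ReflTransGen r a c →
    ∃ d : α, Relation.ReflTransGen r b d ∧ Relation.ReflTransGen r c d

/-- An object to which no rewrite rule applies. -/
def IsNormal {α : Type*} (r : α → α → Prop) (a : α) : Prop :=
  ∀ b : α, ¬ r a b

/-- `b` is a normal form of `a`: it is reachable from `a` and no rule applies to it. -/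
def IsNormalFormOf {α : Type*} (r : α → α → Prop) (b a : α) : Prop :=
  Relation.ReflTransGen r a b ∧ IsNormal r b

/-! ### Skew semistandard tableaux -/

/-- A skew semistandard tableau of shape `outer / inner`, with entries in `ℕ`.
The square `(i, j)` lies in row `i` and column `j`, both counted from `0`.
As for Mathlib's `SemistandardYoungTableau`, entries outside the diagram are required to be zero, so
that equality of tableaux means equality of the shapes and of the entries in the diagram. -/
@[ext]
structure SkewSSYT where
  outer : YoungDiagram
  inner : YoungDiagram
  inner_le_outer : inner ≤ outer
  entry : ℕ → ℕ → ℕ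
  row_weak : ∀ i j₁ j₂ : ℕ, j₁ < j₂ → (i, j₁) ∉ inner → (i, j₂) ∈ outer →
    entry i j₁ ≤ entry i j₂
  col_strict : ∀ i₁ i₂ j : ℕ, i₁ < i₂ → (i₁, j) ∉ inner → (i₂, j) ∈ outer →
    entry i₁ j < entry i₂ j
  entry_eq_zero : ∀ i j : ℕ, ¬ ((i, j) ∈ outer ∧ (i, j) ∉ inner) → entry i j = 0

namespace SkewSSYT

/-- The squares of the skew diagram of `T`. -/
def cells (T : SkewSSYT) : Finset (ℕ × ℕ) :=
  T.outer.cells \ T.inner.cells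

/-- `T` is a semistandard Young tableau, i.e. a tableau of partition shape `outer / 0`. -/
def IsYoung (T : SkewSSYT) : Prop :=
  T.inner = ⊥

/-! ### Inward jeu de taquin slides -/

/-- Move the entry of the square `src` into the (empty) square `dst`, leaving `src` empty. -/
def moveEntry (f : ℕ → ℕ → ℕ) (src dst : ℕ × ℕ) : ℕ → ℕ → ℕ := fun i j =>
  if (i, j) = dst then f src.1 src.2 else if (i, j) = src then 0 else f i j

/-- One elementary move of an inward slide inside the diagram `outer`, on tableaux with an empty
square. The smaller of the entries right below and right of the empty square is moved into it; if
both are equal, it is the one below. -/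
inductive SlideMove (outer : YoungDiagram) :
    (ℕ × ℕ) × (ℕ → ℕ → ℕ) → (ℕ × ℕ) × (ℕ → ℕ → ℕ) → Prop
  | up (i j : ℕ) (f : ℕ → ℕ → ℕ) (below : (i + 1, j) ∈ outer)
      (le : (i, j + 1) ∈ outer → f (i + 1) j ≤ f i (j + 1)) :
      SlideMove outer ((i, j), f) ((i + 1, j), moveEntry f (i + 1, j) (i, j))
  | left (i j : ℕ) (f : ℕ → ℕ → ℕ) (right : (i, j + 1) ∈ outer)
      (lt : (i + 1, j) ∈ outer → f i (j + 1) < f (i + 1) j) :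
      SlideMove outer ((i, j), f) ((i, j + 1), moveEntry f (i, j + 1) (i, j))

/-- `T'` is obtained from `T` by an inward jeu de taquin slide into some corner `c` of the inner
shape of `T`: the empty square moves from `c` until it reaches a square `d` that has no square of
the outer shape below it or to its right. Then `c` is removed from the inner shape and `d` from the
outer shape. (That `c` and `d` are corners is implied, as the shapes of `T'` are Young diagrams.) -/
def InwardSlide (T T' : SkewSSYT) : Prop :=
  ∃ c ∈ T.inner, ∃ d ∈ T.outer,
    T'.inner.cells = T.inner.cells.erase c ∧
    T'.outer.cells = T.outer.cells.erase d ∧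
    (d.1 + 1, d.2) ∉ T.outer ∧ (d.1, d.2 + 1) ∉ T.outer ∧
    Relation.ReflTransGen (SlideMove T.outer) (c, T.entry) (d, T'.entry)

end SkewSSYT

/-! ### Raising operations on words -/

/-- Every prefix of `w` contains at least as many letters `i` as letters `i + 1`. -/
def DominantFor (i : ℕ) (w : List ℕ) : Prop :=
  ∀ u : List ℕ, u <+: w → u.count (i + 1) ≤ u.count i

/-- Every suffix of `w` contains at least as many letters `i + 1` as letters `i`. -/
def AntidominantFor (i : ℕ) (w : List ℕ) : Prop :=
  ∀ u : List ℕ, u <:+ w → u.count i ≤ u.count (i + 1)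

/-- `w = e_i(w')`: one has `w' = u (i+1) v` and `w = u i v` with `u` anti-dominant for `i` and `v`
dominant for `i`. -/
def RaisesWord (i : ℕ) (w' w : List ℕ) : Prop :=
  ∃ u v : List ℕ, w' = u ++ (i + 1) :: v ∧ w = u ++ i :: v ∧
    AntidominantFor i u ∧ DominantFor i v

namespace SkewSSYT

/-! ### Raising operations on tableaux -/

/-- A valid reading order for the diagram of `T`, given by the list of its squares in increasing
order: a total order in which `(i, j)` precedes `(i', j')` whenever these squares are distinct,
`i ≤ i'` and `j ≥ j'`. -/
def IsReadingOrder (T : SkewSSYT) (s : List (ℕ × ℕ)) : Prop :=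
  s.Nodup ∧ (∀ c : ℕ × ℕ, c ∈ s ↔ c ∈ T.cells) ∧
    s.Pairwise fun a b => ¬ (b.1 ≤ a.1 ∧ a.2 ≤ b.2)

/-- The word formed by the entries of `T` in the squares of the list `s`. -/
def readWord (T : SkewSSYT) (s : List (ℕ × ℕ)) : List ℕ :=
  s.map fun c => T.entry c.1 c.2

/-- `U = e_i(T)`: the tableau `U` has the same shape as `T`, and its reading word is obtained by
applying `e_i` to the reading word of `T`, for some valid reading order. -/
def Raises (i : ℕ) (T U : SkewSSYT) : Prop :=
  U.outer = T.outer ∧ U.inner = T.inner ∧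
    ∃ s : List (ℕ × ℕ), T.IsReadingOrder s ∧ RaisesWord i (T.readWord s) (U.readWord s)

/-- `U` is obtained from `T` by some raising operation `e_i`. -/
def RaisingStep (T U : SkewSSYT) : Prop :=
  ∃ i : ℕ, Raises i T U

/-! ### Littlewood-Richardson tableaux -/

/-- The entries of `T`, read by rows from top to bottom, each row from right to left. -/
def rowWord (T : SkewSSYT) : List ℕ :=
  (List.range (T.outer.colLen 0)).flatMap fun i =>
    (List.range' (T.inner.rowLen i) (T.outer.rowLen i - T.inner.rowLen i)).reverse.map (T.entry i)

/-- `T` is a Littlewood-Richardson tableau: `rowWord T` is a lattice permutation, i.e. the weight of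
each of its prefixes is a partition. -/
def IsLittlewoodRichardson (T : SkewSSYT) : Prop :=
  ∀ u : List ℕ, u <+: T.rowWord → ∀ i : ℕ, u.count (i + 1) ≤ u.count i

end SkewSSYT

/-!
A tableau is a chain of partitions, each obtained from the previous one by adding a horizontal
strip, that is, an interlacing pattern of row lengths. In terms of patterns an inward slide removes
one square from each partition of the chain, and `e_i` adds one square to the `(i + 1)`-st of them.
Both kinds of steps can be undone once a slide is labelled by its starting row and by the outer
shape, and the two kinds of labelled steps commute: either one can be transported along the other.

Littlewood-Richardson tableaux are preserved by slides, and Young tableaux by raising operations. A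
tableau of both kinds has all entries of row `r` equal to `r`, so it is determined by its outer
shape, and also by its weight. Two normal forms for slides of `T` can be transported along a
sequence of raising operations from `T` to a Littlewood-Richardson tableau; there they become
tableaux of both kinds with the same weight, hence equal, and undoing the raising operations shows
that they were equal in the first place. The argument for raising operations is the same, with outer
shapes in place of weights. Finally, `T` is recovered from its normal forms `P` and `L`, because the
slides from `T` to `P` are also the slides from `L` to its normal form, up to transport.
-/

section Rewriting

variable {α ι κ : Type*} {r s t : α → α → Prop}

theorem IsNormalFormOf.confluent (exists_nf : ∀ a, ∃ b, IsNormalFormOf r b a)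
    (unique_nf : ∀ ⦃a b c⦄, IsNormalFormOf r b a → IsNormalFormOf r c a → b = c) :
    Confluent r := by
  intro a b c hab hac
  obtain ⟨m, hbm, hm⟩ := exists_nf b
  obtain ⟨n, hcn, hn⟩ := exists_nf c
  obtain rfl := unique_nf ⟨hab.trans hbm, hm⟩ ⟨hac.trans hcn, hn⟩
  exact ⟨m, hbm, hcn⟩

theorem exists_isNormalFormOf_of_measure (f : α → ℕ) (hf : ∀ a b, r a b → f b < f a) (a : α) :
    ∃ b, IsNormalFormOf r b a := by
  induction hn : f a using Nat.strong_induction_on generalizing a with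
  | _ n ih =>
    by_cases ha : IsNormal r a
    · exact ⟨a, .refl, ha⟩
    · obtain ⟨b, hab⟩ : ∃ b, r a b := by simpa [IsNormal] using ha
      obtain ⟨c, hbc, hc⟩ := ih (f b) (hn ▸ hf a b hab) b rfl
      exact ⟨c, .head hab hbc, hc⟩

theorem IsNormal.eq_of_reflTransGen {a b : α} (ha : IsNormal r a)
    (h : Relation.ReflTransGen r a b) : a = b :=
  h.cases_head.resolve_right fun ⟨c, hac, _⟩ => ha c hac

theorem isNormalFormOf_unique_of_rightUnique (hr : Relator.RightUnique r) {a b c : α}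
    (hb : IsNormalFormOf r b a) (hc : IsNormalFormOf r c a) : b = c :=
  (Relation.ReflTransGen.total_of_right_unique hr hb.1 hc.1).elim hb.2.eq_of_reflTransGen
    fun h => (hc.2.eq_of_reflTransGen h).symm

/-- The relations `r` and `s` commute: an `r`-step and an `s`-step from the same object can be
completed to a square whose opposite sides are steps of the same kind. -/
def Diamond (r s : α → α → Prop) : Prop :=
  ∀ ⦃a b c⦄, r a b → s a c → ∃ d, s b d ∧ r c d

theorem Diamond.symm (h : Diamond r s) : Diamond s r := fun _ _ _ hb hc =>
  (h hc hb).imp fun _ => And.symm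

theorem Diamond.comp_left (hr : Diamond r t) (hs : Diamond s t) :
    Diamond (Relation.Comp r s) t := by
  rintro a b c ⟨m, ham, hmb⟩ hac
  obtain ⟨n, hmn, hcn⟩ := hr ham hac
  obtain ⟨d, hbd, hnd⟩ := hs hmb hmn
  exact ⟨d, hbd, n, hcn, hnd⟩

/-- One step of any of the relations of a family. -/
def Step (S : ι → α → α → Prop) (a b : α) : Prop :=
  ∃ x, S x a b

/-- A sequence of steps whose labels are prescribed by a list. -/
def Steps (S : ι → α → α → Prop) : List ι → α → α → Prop
  | [] => Eq
  | x :: l => Relation.Comp (S x) (Steps S l)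

theorem reflTransGen_step_iff {S : ι → α → α → Prop} {a b : α} :
    Relation.ReflTransGen (Step S) a b ↔ ∃ l, Steps S l a b := by
  constructor
  · intro h
    induction h using Relation.ReflTransGen.head_induction_on with
    | refl => exact ⟨[], rfl⟩
    | head hac _ ih =>
      obtain ⟨x, hx⟩ := hac
      obtain ⟨l, hl⟩ := ih
      exact ⟨x :: l, _, hx, hl⟩
  · rintro ⟨l, hl⟩
    induction l generalizing a with
    | nil => exact hl ▸ .refl
    | cons x l ih =>
      obtain ⟨c, hac, hcb⟩ := hl
      exact .head ⟨x, hac⟩ (ih hcb)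

theorem Diamond.steps_left {S : ι → α → α → Prop} (h : ∀ x, Diamond (S x) t) (l : List ι) :
    Diamond (Steps S l) t := by
  induction l with
  | nil => exact fun a b c hab hac => ⟨c, hab ▸ hac, rfl⟩
  | cons x l ih => exact (h x).comp_left ih

theorem Diamond.flip_steps_left {S : ι → α → α → Prop} (h : ∀ x, Diamond (flip (S x)) t)
    (l : List ι) : Diamond (flip (Steps S l)) t := by
  induction l with
  | nil => exact fun a b c hba hac => ⟨c, (show b = a from hba) ▸ hac, rfl⟩
  | cons x l ih =>
    rw [Steps, Relation.flip_comp]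
    exact ih.comp_left (h x)

theorem leftUnique_steps {S : ι → α → α → Prop} (h : ∀ x, Relator.LeftUnique (S x))
    (l : List ι) : Relator.LeftUnique (Steps S l) := by
  induction l with
  | nil => exact fun a b c hac hbc => hac.trans hbc.symm
  | cons x l ih =>
    rintro a b c ⟨m, ham, hmc⟩ ⟨n, hbn, hnc⟩
    obtain rfl := ih hmc hnc
    exact h x ham hbn

variable {S : ι → α → α → Prop} {R : κ → α → α → Prop}

theorem IsNormal.of_steps (h : ∀ y a b, R y a b → IsNormal s a → IsNormal s b) {l : List κ}
    {a b : α} (hab : Steps R l a b) (ha : IsNormal s a) : IsNormal s b := by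
  induction l generalizing a with
  | nil => exact hab ▸ ha
  | cons y l ih =>
    obtain ⟨c, hac, hcb⟩ := hab
    exact ih hcb (h y a c hac ha)

theorem Diamond.exists_common_reduct (comm : ∀ x y, Diamond (S x) (R y))
    (R_preserves : ∀ y a b, R y a b → IsNormal (Step S) a → IsNormal (Step S) b)
    {a p : α} (hp : IsNormalFormOf (Step S) p a) :
    ∃ l, Steps S l a p ∧ ∀ {m : List κ} {n : α}, Steps R m a n →
      ∃ q, Steps R m p q ∧ Steps S l n q ∧ IsNormalFormOf (Step S) q n := by
  obtain ⟨l, hl⟩ := reflTransGen_step_iff.1 hp.1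
  refine ⟨l, hl, fun {m n} hm => ?_⟩
  have hdiamond : Diamond (Steps S l) (Steps R m) :=
    Diamond.steps_left (fun x => (Diamond.steps_left (fun y => (comm x y).symm) m).symm) l
  obtain ⟨q, hpq, hnq⟩ := hdiamond hl hm
  exact ⟨q, hpq, hnq, reflTransGen_step_iff.2 ⟨l, hnq⟩, hp.2.of_steps R_preserves hpq⟩

theorem Diamond.isNormalFormOf_unique (comm : ∀ x y, Diamond (S x) (R y))
    (R_leftUnique : ∀ y, Relator.LeftUnique (R y))
    (R_preserves : ∀ y a b, R y a b → IsNormal (Step S) a → IsNormal (Step S) b)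
    (unique : ∀ n p q, IsNormal (Step R) n → IsNormalFormOf (Step S) p n →
      IsNormalFormOf (Step S) q n → p = q)
    (R_exists : ∀ a, ∃ n, IsNormalFormOf (Step R) n a) {a p q : α}
    (hp : IsNormalFormOf (Step S) p a) (hq : IsNormalFormOf (Step S) q a) : p = q := by
  obtain ⟨n, han, hn⟩ := R_exists a
  obtain ⟨m, hm⟩ := reflTransGen_step_iff.1 han
  obtain ⟨_, _, complete_p⟩ := exists_common_reduct comm R_preserves hp
  obtain ⟨_, _, complete_q⟩ := exists_common_reduct comm R_preserves hq
  obtain ⟨p', hpp', -, hp'⟩ := complete_p hm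
  obtain ⟨q', hqq', -, hq'⟩ := complete_q hm
  obtain rfl := unique n p' q' hn hp' hq'
  exact leftUnique_steps R_leftUnique m hpp' hqq'

theorem Diamond.eq_of_isNormalFormOf (comm : ∀ x y, Diamond (S x) (R y))
    (comm_flip : ∀ x y, Diamond (S x) (flip (R y)))
    (S_leftUnique : ∀ x, Relator.LeftUnique (S x)) (R_leftUnique : ∀ y, Relator.LeftUnique (R y))
    (R_preserves : ∀ y a b, R y a b → IsNormal (Step S) a → IsNormal (Step S) b)
    (unique : ∀ a p q, IsNormalFormOf (Step S) p a → IsNormalFormOf (Step S) q a → p = q)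
    {a b p n : α} (hap : IsNormalFormOf (Step S) p a) (han : Relation.ReflTransGen (Step R) a n)
    (hbp : IsNormalFormOf (Step S) p b) (hbn : Relation.ReflTransGen (Step R) b n) : a = b := by
  obtain ⟨k, hk⟩ := reflTransGen_step_iff.1 han
  obtain ⟨m, hm⟩ := reflTransGen_step_iff.1 hbn
  obtain ⟨l, hl, complete_a⟩ := exists_common_reduct comm R_preserves hap
  obtain ⟨_, _, complete_b⟩ := exists_common_reduct comm R_preserves hbp
  obtain ⟨q, -, hnq, hq⟩ := complete_a hk
  obtain ⟨q', hpq', -, hq'⟩ := complete_b hm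
  obtain rfl := unique n q q' hq hq'
  have hdiamond : Diamond (Steps S l) (flip (Steps R m)) := Diamond.steps_left
    (fun x => (Diamond.flip_steps_left (fun y => (comm_flip x y).symm) m).symm) l
  obtain ⟨p', hp'q, hbp'⟩ := hdiamond hnq hm
  obtain rfl := leftUnique_steps R_leftUnique m hpq' hp'q
  exact leftUnique_steps S_leftUnique l hl hbp'

end Rewriting

/-! ### Interlacing patterns -/

/-- A chain of sequences `g 0 ≤ g 1 ≤ ⋯` in which successive terms interlace. Reading `g k r` as the
length of row `r` of the `k`-th partition, successive partitions differ by horizontal strips. -/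
structure Interlacing (g : ℕ → ℕ → ℕ) : Prop where
  mono : ∀ k r, g k r ≤ g (k + 1) r
  interlace : ∀ k r, g (k + 1) (r + 1) ≤ g k r

/-- A Gelfand-Tsetlin pattern: an eventually constant chain of interlacing partitions. -/
structure IsGTPattern (g : ℕ → ℕ → ℕ) : Prop extends Interlacing g where
  bounded : ∃ N, (∀ k, N ≤ k → g k = g N) ∧ ∀ r, N ≤ r → g N r = 0

namespace Interlacing

variable {g : ℕ → ℕ → ℕ}

protected theorem monotone (hg : Interlacing g) (r : ℕ) : Monotone fun k => g k r :=
  monotone_nat_of_le_succ fun k => hg.mono k r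

protected theorem antitone (hg : Interlacing g) (k : ℕ) : Antitone (g k) :=
  antitone_nat_of_succ_le fun r => (hg.mono k (r + 1)).trans (hg.interlace k r)

theorem le_of_eventually_eq (hg : Interlacing g) {N : ℕ} (hN : ∀ k, N ≤ k → g k = g N)
    (k r : ℕ) : g k r ≤ g N r := by
  rcases le_total k N with h | h
  · exact hg.monotone r h
  · rw [hN k h]

end Interlacing

/-- The rows of the squares that are successively removed from the partitions of a pattern
when a square is removed from row `r` of its first partition: a square is passed on to the next row
exactly when its removal from the same row would violate the interlacing condition. -/
def slideRow (g : ℕ → ℕ → ℕ) (r : ℕ) : ℕ → ℕ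
  | 0 => r
  | k + 1 => if g (k + 1) (slideRow g r k + 1) = g k (slideRow g r k) then slideRow g r k + 1
      else slideRow g r k

/-- The pattern obtained by removing a square from row `r` of the first partition, and propagating
the change along the chain. -/
def slidePattern (g : ℕ → ℕ → ℕ) (r k s : ℕ) : ℕ :=
  g k s - if s = slideRow g r k then 1 else 0

section Slide

variable {g g' : ℕ → ℕ → ℕ} {r : ℕ}

theorem slideRow_succ_cases (g : ℕ → ℕ → ℕ) (r k : ℕ) :
    (g (k + 1) (slideRow g r k + 1) = g k (slideRow g r k) ∧
      slideRow g r (k + 1) = slideRow g r k + 1) ∨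
    (g (k + 1) (slideRow g r k + 1) ≠ g k (slideRow g r k) ∧
      slideRow g r (k + 1) = slideRow g r k) := by
  rw [slideRow]
  split_ifs with h <;> simp [h]

theorem slidePattern_le (g : ℕ → ℕ → ℕ) (r k s : ℕ) : slidePattern g r k s ≤ g k s :=
  Nat.sub_le _ _

namespace Interlacing

theorem slideRow_corner (hg : Interlacing g) (hr : g 0 (r + 1) < g 0 r) (k : ℕ) :
    g k (slideRow g r k + 1) < g k (slideRow g r k) := by
  induction k with
  | zero => exact hr
  | succ k ih =>
    have h1 := hg.interlace k (slideRow g r k)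
    have h2 := hg.interlace k (slideRow g r k + 1)
    have h3 := hg.mono k (slideRow g r k)
    rcases slideRow_succ_cases g r k with ⟨h, e⟩ | ⟨h, e⟩ <;> rw [e] <;> lia

theorem slidePattern_add (hg : Interlacing g) (hr : g 0 (r + 1) < g 0 r) (k s : ℕ) :
    slidePattern g r k s + (if s = slideRow g r k then 1 else 0) = g k s := by
  have := hg.slideRow_corner hr k
  unfold slidePattern
  split_ifs with h
  · subst h; lia
  · rfl

theorem slidePattern_slideRow_add_one (hg : Interlacing g) (hr : g 0 (r + 1) < g 0 r) (k : ℕ) :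
    slidePattern g r k (slideRow g r k) + 1 = g k (slideRow g r k) := by
  simpa using hg.slidePattern_add hr k (slideRow g r k)

theorem slideRow_eventually (hg : Interlacing g) (hr : g 0 (r + 1) < g 0 r) {N : ℕ}
    (hN : ∀ k, N ≤ k → g k = g N) (k : ℕ) (hk : N ≤ k) : slideRow g r k = slideRow g r N := by
  induction k, hk using Nat.le_induction with
  | base => rfl
  | succ k hk ih =>
    have hcorner := hg.slideRow_corner hr k
    rcases slideRow_succ_cases g r k with ⟨h, e⟩ | ⟨-, e⟩
    · rw [hN (k + 1) (by lia), ← hN k hk] at h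
      lia
    · rw [e, ih]

protected theorem slidePattern (hg : Interlacing g) (hr : g 0 (r + 1) < g 0 r) :
    Interlacing (slidePattern g r) where
  mono k s := by
    have h := hg.mono k s
    have hk := hg.slidePattern_add hr k s
    have hk' := hg.slidePattern_add hr (k + 1) s
    have hcorner := hg.slideRow_corner hr k
    rcases slideRow_succ_cases g r k with ⟨h, e⟩ | ⟨h, e⟩ <;> rw [e] at hk' <;> grind
  interlace k s := by
    have h := hg.interlace k s
    have hk := hg.slidePattern_add hr k s
    have hk' := hg.slidePattern_add hr (k + 1) (s + 1)
    rcases slideRow_succ_cases g r k with ⟨h, e⟩ | ⟨h, e⟩ <;> rw [e] at hk' <;> grind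

/-- A slide can be traced backwards in the pattern it produces. -/
theorem slideRow_succ_eq_iff (hg : Interlacing g) (hr : g 0 (r + 1) < g 0 r) (k : ℕ) :
    slideRow g r (k + 1) = slideRow g r k + 1 ↔ ∃ p, slideRow g r (k + 1) = p + 1 ∧
      slidePattern g r k p = slidePattern g r (k + 1) (p + 1) := by
  have hk := hg.slidePattern_slideRow_add_one hr k
  have hk' := hg.slidePattern_slideRow_add_one hr (k + 1)
  constructor
  · intro e
    refine ⟨_, e, ?_⟩
    rcases slideRow_succ_cases g r k with ⟨h, -⟩ | ⟨-, e'⟩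
    · rw [e] at hk'; lia
    · lia
  · rintro ⟨p, e, hp⟩
    rcases slideRow_succ_cases g r k with ⟨-, e'⟩ | ⟨-, e'⟩
    · exact e'
    · have hint := hg.interlace k p
      have hadd := hg.slidePattern_add hr k p
      rw [if_neg (by lia)] at hadd
      rw [e] at hk'
      lia

theorem slidePattern_injective (hg : Interlacing g) (hg' : Interlacing g')
    (hr : g 0 (r + 1) < g 0 r) (hr' : g' 0 (r + 1) < g' 0 r)
    (he : slidePattern g r = slidePattern g' r)
    (hfin : ∀ᶠ k in Filter.atTop, g k = g' k) : g = g' := by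
  obtain ⟨N, hN⟩ := Filter.eventually_atTop.1 hfin
  have hlast : ∀ k, N ≤ k → slideRow g r k = slideRow g' r k := fun k hk => by
    have h := hg.slidePattern_add hr k (slideRow g r k)
    rw [he, hN k hk, ← hg'.slidePattern_add hr' k (slideRow g r k)] at h
    by_contra hne
    simp [hne] at h
  have hback : ∀ k, slideRow g r (k + 1) = slideRow g' r (k + 1) →
      slideRow g r k = slideRow g' r k := fun k hk => by
    have h := hg.slideRow_succ_eq_iff hr k
    have h' := hg'.slideRow_succ_eq_iff hr' k
    rw [he, hk, ← h'] at h
    rcases slideRow_succ_cases g r k with ⟨-, e⟩ | ⟨-, e⟩ <;>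
      rcases slideRow_succ_cases g' r k with ⟨-, e'⟩ | ⟨-, e'⟩ <;> lia
  have hrow : ∀ k, slideRow g r k = slideRow g' r k := fun k =>
    Nat.decreasingInduction' (P := fun k => slideRow g r k = slideRow g' r k)
      (fun k _ _ ih => hback k ih) (le_max_left k N) (hlast _ (le_max_right k N))
  funext k s
  rw [← hg.slidePattern_add hr, ← hg'.slidePattern_add hr', he, hrow]

end Interlacing

protected theorem IsGTPattern.slidePattern (hg : IsGTPattern g) (hr : g 0 (r + 1) < g 0 r) :
    IsGTPattern (slidePattern g r) where
  toInterlacing := hg.toInterlacing.slidePattern hr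
  bounded := by
    obtain ⟨N, hN, hzero⟩ := hg.bounded
    refine ⟨N, fun k hk => ?_, fun s hs => ?_⟩
    · funext s
      rw [slidePattern, slidePattern, hg.slideRow_eventually hr hN k hk, hN k hk]
    · exact Nat.eq_zero_of_le_zero (hzero s hs ▸ slidePattern_le g r N s)

end Slide

/-! ### Raising operations on patterns -/

/-- The excess of letters `i` over letters `i + 1` in the rows up to `r`, where row `r`
contributes only its letters `i + 1`: these are read before its letters `i`. -/
def height (g : ℕ → ℕ → ℕ) (i r : ℕ) : ℤ :=
  ∑ s ∈ Finset.range r, ((g (i + 1) s : ℤ) - g i s) -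
    ∑ s ∈ Finset.range (r + 1), ((g (i + 2) s : ℤ) - g (i + 1) s)

/-- The first minimum of `h` is at `r`, and is negative. -/
structure IsRaiseRow (h : ℕ → ℤ) (r : ℕ) : Prop where
  neg : h r < 0
  lt_of_lt : ∀ s, s < r → h r < h s
  le_of_le : ∀ s, r ≤ s → h r ≤ h s

/-- The pattern obtained by changing an entry `i + 1` of row `r` into `i`. -/
def raiseAt (g : ℕ → ℕ → ℕ) (i r k s : ℕ) : ℕ :=
  g k s + if k = i + 1 ∧ s = r then 1 else 0

/-- `g'` is the pattern obtained from `g` by the `i`-th raising operation. -/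
def RaisesPattern (i : ℕ) (g g' : ℕ → ℕ → ℕ) : Prop :=
  ∃ r, IsRaiseRow (height g i) r ∧ g' = raiseAt g i r

section Raise

variable {g : ℕ → ℕ → ℕ} {i r : ℕ}

theorem height_zero (g : ℕ → ℕ → ℕ) (i : ℕ) : height g i 0 = g (i + 1) 0 - g (i + 2) 0 := by
  simp [height]

theorem height_succ (g : ℕ → ℕ → ℕ) (i r : ℕ) : height g i (r + 1) =
    height g i r + (g (i + 1) r - g (i + 2) (r + 1)) - (g i r - g (i + 1) (r + 1)) := by
  simp only [height, Finset.sum_range_succ _ r, Finset.sum_range_succ _ (r + 1)]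
  ring

theorem IsRaiseRow.unique {h : ℕ → ℤ} {r s : ℕ} (hr : IsRaiseRow h r) (hs : IsRaiseRow h s) :
    r = s := by
  by_contra hne
  rcases Nat.lt_or_gt_of_ne hne with hlt | hlt
  · exact absurd (hr.le_of_le s hlt.le) (not_le.2 (hs.lt_of_lt r hlt))
  · exact absurd (hs.le_of_le r hlt.le) (not_le.2 (hr.lt_of_lt s hlt))

theorem raiseAt_of_ne {k : ℕ} (h : k ≠ i + 1) : raiseAt g i r k = g k := by
  funext s; simp [raiseAt, h]

theorem Interlacing.lt_of_isRaiseRow (hg : Interlacing g) (h : IsRaiseRow (height g i) r) :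
    g (i + 1) r < g (i + 2) r ∧ ∀ s, r = s + 1 → g (i + 1) r < g i s := by
  rcases r with _ | s
  · have := h.neg
    rw [height_zero] at this
    exact ⟨by lia, fun s hs => by lia⟩
  · have hlt := h.lt_of_lt s (Nat.lt_succ_self s)
    rw [height_succ] at hlt
    have h1 := hg.interlace i s
    have h2 := hg.interlace (i + 1) s
    have h3 := hg.mono (i + 1) (s + 1)
    have h4 := hg.mono i s
    refine ⟨by lia, fun t ht => ?_⟩
    obtain rfl : s = t := by lia
    lia

protected theorem Interlacing.raiseAt (hg : Interlacing g) (h : IsRaiseRow (height g i) r) :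
    Interlacing (raiseAt g i r) where
  mono k s := by
    have h1 := hg.mono k s
    have h2 := (hg.lt_of_isRaiseRow h).1
    unfold raiseAt
    split_ifs <;> grind
  interlace k s := by
    have h1 := hg.interlace k s
    have h2 := (hg.lt_of_isRaiseRow h).2 s
    unfold raiseAt
    split_ifs <;> grind

protected theorem IsGTPattern.raiseAt (hg : IsGTPattern g) (h : IsRaiseRow (height g i) r) :
    IsGTPattern (raiseAt g i r) where
  toInterlacing := hg.toInterlacing.raiseAt h
  bounded := by
    obtain ⟨N, hN, hzero⟩ := hg.bounded
    refine ⟨max N (i + 2), fun k hk => ?_, fun s hs => ?_⟩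
    · rw [raiseAt_of_ne (by lia), raiseAt_of_ne (by lia), hN k (by lia), hN _ (le_max_left _ _)]
    · rw [raiseAt_of_ne (by lia), hN _ (le_max_left _ _), hzero s (by lia)]

theorem height_raiseAt (g : ℕ → ℕ → ℕ) (i r s : ℕ) : height (raiseAt g i r) i s =
    height g i s + (if r < s then 1 else 0) + (if r ≤ s then 1 else 0) := by
  have hmid : ∀ t, (raiseAt g i r (i + 1) t : ℤ) = g (i + 1) t + if t = r then 1 else 0 := by
    simp [raiseAt]
  simp only [height, hmid, raiseAt_of_ne (show i ≠ i + 1 by lia),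
    raiseAt_of_ne (show i + 2 ≠ i + 1 by lia), Finset.sum_sub_distrib, Finset.sum_add_distrib,
    Finset.sum_ite_eq', Finset.mem_range, Nat.lt_succ_iff]
  ring

theorem leftUnique_raisesPattern (i : ℕ) : Relator.LeftUnique (RaisesPattern i) := by
  have row_le : ∀ {g₁ g₂ r₁ r₂}, IsRaiseRow (height g₁ i) r₁ → IsRaiseRow (height g₂ i) r₂ →
      raiseAt g₁ i r₁ = raiseAt g₂ i r₂ → r₁ ≤ r₂ := by
    intro g₁ g₂ r₁ r₂ h₁ h₂ e
    by_contra! hlt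
    have hrow := height_raiseAt g₁ i r₁
    simp only [e, height_raiseAt g₂ i r₂] at hrow
    have := hrow r₁
    have := hrow r₂
    have := h₁.lt_of_lt r₂ hlt
    have := h₂.le_of_le r₁ hlt.le
    grind
  rintro g₁ g₂ g ⟨r₁, h₁, rfl⟩ ⟨r₂, h₂, e⟩
  obtain rfl : r₁ = r₂ := le_antisymm (row_le h₁ h₂ e) (row_le h₂ h₁ e.symm)
  funext k s
  simpa [raiseAt] using congrFun₂ e k s

end Raise

/-! ### Commutation of slides and raising operations -/

section Commutation

variable {g : ℕ → ℕ → ℕ} {i m r : ℕ}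

theorem Interlacing.height_slidePattern (hg : Interlacing g) (hr : g 0 (r + 1) < g 0 r)
    (i s : ℕ) : height (slidePattern g r) i s = height g i s +
      if s = slideRow g r (i + 1) then
        2 * (slideRow g r (i + 1) : ℤ) - slideRow g r i - slideRow g r (i + 2) else 0 := by
  have hval : ∀ k t, (slidePattern g r k t : ℤ) =
      g k t - if t = slideRow g r k then 1 else 0 := fun k t => by
    rw [← hg.slidePattern_add hr k t]
    push_cast
    ring
  have h1 := slideRow_succ_cases g r i
  have h2 := slideRow_succ_cases g r (i + 1)
  simp only [height, hval, Finset.sum_sub_distrib, Finset.sum_ite_eq', Finset.mem_range,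
    Nat.lt_succ_iff]
  split_ifs <;> lia

theorem Interlacing.height_succ_slideRow (hg : Interlacing g)
    (h1 : slideRow g r (i + 1) = slideRow g r i)
    (h2 : slideRow g r (i + 2) = slideRow g r i + 1) :
    g (i + 1) (slideRow g r i + 1) < g i (slideRow g r i) ∧
      height g i (slideRow g r i + 1) =
        height g i (slideRow g r i) - (g i (slideRow g r i) - g (i + 1) (slideRow g r i + 1)) := by
  have hint := hg.interlace i (slideRow g r i)
  have hheight := height_succ g i (slideRow g r i)
  have hne := slideRow_succ_cases g r i
  have heq := slideRow_succ_cases g r (i + 1)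
  rw [h1] at heq
  grind

theorem Interlacing.height_slidePattern_nonneg (hg : Interlacing g) (hr : g 0 (r + 1) < g 0 r)
    (h : ∀ s, 0 ≤ height g i s) (s : ℕ) : 0 ≤ height (slidePattern g r) i s := by
  have hs := h s
  have hlow := h (slideRow g r i + 1)
  rw [hg.height_slidePattern hr]
  rcases slideRow_succ_cases g r i with ⟨-, h1⟩ | ⟨-, h1⟩ <;>
    rcases slideRow_succ_cases g r (i + 1) with ⟨-, h2⟩ | ⟨-, h2⟩
  · grind
  · grind
  · have := hg.height_succ_slideRow h1 (h2.trans (by rw [h1]))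
    grind
  · grind

theorem Interlacing.slideRow_eq_of_isRaiseRow (hg : Interlacing g)
    (hm : IsRaiseRow (height g i) m) (h : slideRow g r (i + 1) = m) :
    slideRow g r i = m ∧ slideRow g r (i + 2) = m := by
  have h1 : slideRow g r i = m := by
    rcases slideRow_succ_cases g r i with ⟨heq, e⟩ | ⟨-, e⟩
    · have := (hg.lt_of_isRaiseRow hm).2 (slideRow g r i) (by lia)
      rw [← e, h] at heq
      lia
    · lia
  refine ⟨h1, ?_⟩
  rcases slideRow_succ_cases g r (i + 1) with ⟨-, e⟩ | ⟨-, e⟩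
  · have hdrop := hg.height_succ_slideRow (h.trans h1.symm) (e.trans (by rw [h, h1]))
    rw [h1] at hdrop
    have := hm.le_of_le (m + 1) (Nat.le_succ m)
    lia
  · exact e.trans h

/-- Raising makes the slide enter row `m` one level earlier. -/
def RaiseMovesSlide (g : ℕ → ℕ → ℕ) (r i m : ℕ) : Prop :=
  m = slideRow g r i + 1 ∧ g i (slideRow g r i) = g (i + 1) m + 1

theorem Interlacing.slideRow_raiseAt (hg : Interlacing g) (hm : IsRaiseRow (height g i) m)
    (h : ¬ RaiseMovesSlide g r i m) (k : ℕ) :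
    slideRow (raiseAt g i m) r k = slideRow g r k := by
  induction k with
  | zero => rfl
  | succ k ih =>
    suffices htest : raiseAt g i m (k + 1) (slideRow g r k + 1) = raiseAt g i m k (slideRow g r k) ↔
        g (k + 1) (slideRow g r k + 1) = g k (slideRow g r k) by
      simp only [slideRow, ih, htest]
    rcases eq_or_ne k i with rfl | hki
    · have hlt := (hg.lt_of_isRaiseRow hm).2 (slideRow g r k)
      simp only [raiseAt, RaiseMovesSlide] at h ⊢
      grind
    rcases eq_or_ne k (i + 1) with rfl | hki'
    · have hstay := hg.slideRow_eq_of_isRaiseRow hm (r := r)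
      have hint := hg.interlace (i + 1) m
      have hcases := slideRow_succ_cases g r (i + 1)
      simp only [raiseAt]
      grind
    · simp [raiseAt, hki, hki']

theorem Interlacing.isRaiseRow_slidePattern (hg : Interlacing g) (hr : g 0 (r + 1) < g 0 r)
    (hm : IsRaiseRow (height g i) m) (h : ¬ RaiseMovesSlide g r i m) :
    IsRaiseRow (height (slidePattern g r) i) m := by
  have hheight := hg.height_slidePattern hr i
  have hsame : height (slidePattern g r) i m = height g i m := by
    have := hg.slideRow_eq_of_isRaiseRow hm (r := r)
    grind
  by_cases hlag : slideRow g r (i + 1) = slideRow g r i ∧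
      slideRow g r (i + 2) = slideRow g r i + 1
  · obtain ⟨hgap, hdrop⟩ := hg.height_succ_slideRow hlag.1 hlag.2
    rw [RaiseMovesSlide] at h
    refine ⟨hsame ▸ hm.neg, fun s hs => ?_, fun s hs => ?_⟩
    · have := hm.lt_of_lt s hs
      have := hm.lt_of_lt (s + 1)
      grind
    · have := hm.le_of_le s hs
      have := hm.le_of_le (s + 1) (by lia)
      grind
  · have hle : ∀ s, height g i s ≤ height (slidePattern g r) i s := fun s => by
      have := slideRow_succ_cases g r i
      have := slideRow_succ_cases g r (i + 1)
      grind
    exact ⟨hsame ▸ hm.neg, fun s hs => hsame ▸ (hm.lt_of_lt s hs).trans_le (hle s),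
      fun s hs => hsame ▸ (hm.le_of_le s hs).trans (hle s)⟩

theorem Interlacing.slideRow_of_raiseMovesSlide (hg : Interlacing g)
    (hm : IsRaiseRow (height g i) m) (h : RaiseMovesSlide g r i m) :
    slideRow g r (i + 1) = slideRow g r i ∧ slideRow g r (i + 2) = m := by
  obtain ⟨rfl, heq⟩ := h
  have hlt := hm.lt_of_lt (slideRow g r i) (Nat.lt_succ_self _)
  have hheight := height_succ g i (slideRow g r i)
  have hint := hg.interlace (i + 1) (slideRow g r i)
  have h1 := slideRow_succ_cases g r i
  have h2 := slideRow_succ_cases g r (i + 1)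
  grind

theorem Interlacing.slideRow_raiseAt_of_raiseMovesSlide (hg : Interlacing g)
    (hm : IsRaiseRow (height g i) m) (h : RaiseMovesSlide g r i m) (k : ℕ) :
    slideRow (raiseAt g i m) r k = if k = i + 1 then m else slideRow g r k := by
  obtain ⟨hlevel, hlevel'⟩ := hg.slideRow_of_raiseMovesSlide hm h
  induction k with
  | zero => simp [slideRow]
  | succ k ih =>
    rw [RaiseMovesSlide] at h
    have hint := hg.interlace (i + 1) m
    have hcases := slideRow_succ_cases g r k
    have hcases' := slideRow_succ_cases (raiseAt g i m) r k
    simp only [ih, raiseAt] at hcases'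
    grind

theorem Interlacing.isRaiseRow_slidePattern_of_raiseMovesSlide (hg : Interlacing g)
    (hr : g 0 (r + 1) < g 0 r) (hm : IsRaiseRow (height g i) m) (h : RaiseMovesSlide g r i m) :
    IsRaiseRow (height (slidePattern g r) i) (slideRow g r i) := by
  obtain ⟨hlevel, hlevel'⟩ := hg.slideRow_of_raiseMovesSlide hm h
  have hheight := hg.height_slidePattern hr i
  have hdrop := hg.height_succ_slideRow hlevel (hlevel'.trans h.1)
  rw [RaiseMovesSlide] at h
  refine ⟨?_, fun s hs => ?_, fun s hs => ?_⟩
  · have := hm.neg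
    grind
  · have := hm.lt_of_lt s (by lia)
    grind
  · have := hm.le_of_le s
    grind

theorem Interlacing.raisesPattern_slidePattern (hg : Interlacing g) (hr : g 0 (r + 1) < g 0 r)
    {g' : ℕ → ℕ → ℕ} (h : RaisesPattern i g g') :
    RaisesPattern i (slidePattern g r) (slidePattern g' r) := by
  obtain ⟨m, hm, rfl⟩ := h
  by_cases hmoves : RaiseMovesSlide g r i m
  · refine ⟨slideRow g r i, hg.isRaiseRow_slidePattern_of_raiseMovesSlide hr hm hmoves, ?_⟩
    have hrow := hg.slideRow_raiseAt_of_raiseMovesSlide hm hmoves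
    have hlevel := (hg.slideRow_of_raiseMovesSlide hm hmoves).1
    funext k s
    have := hg.slidePattern_add hr k s
    simp only [slidePattern, hrow, raiseAt] at this ⊢
    grind
  · refine ⟨m, hg.isRaiseRow_slidePattern hr hm hmoves, ?_⟩
    funext k s
    have := hg.slidePattern_add hr k s
    simp only [slidePattern, hg.slideRow_raiseAt hm hmoves, raiseAt] at this ⊢
    lia

end Commutation

/-! ### The pattern of a tableau -/

/-- The Young diagram with row lengths `f`. -/
noncomputable def rowDiagram (f : ℕ → ℕ) (hf : Antitone f) (hzero : ∃ n, f n = 0) :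
    YoungDiagram where
  cells := (Finset.range hzero.choose ×ˢ Finset.range (f 0)).filter fun c => c.2 < f c.1
  isLowerSet := by
    rintro ⟨a, b⟩ ⟨c, d⟩ ⟨hca : c ≤ a, hdb : d ≤ b⟩ h
    have h1 : f a ≤ f c := hf hca
    have h2 := hf (Nat.zero_le c)
    simp only [Finset.coe_filter, Finset.mem_product, Finset.mem_range, Set.mem_ofPred_eq] at h ⊢
    lia

theorem mem_rowDiagram {f : ℕ → ℕ} (hf : Antitone f) (hzero : ∃ n, f n = 0) {r j : ℕ} :
    (r, j) ∈ rowDiagram f hf hzero ↔ j < f r := by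
  rw [← YoungDiagram.mem_cells]
  simp only [rowDiagram, Finset.mem_filter, Finset.mem_product, Finset.mem_range]
  refine ⟨And.right, fun h => ⟨⟨?_, h.trans_le (hf (Nat.zero_le r))⟩, h⟩⟩
  by_contra! hr
  exact absurd (hf hr) (by rw [hzero.choose_spec]; lia)

/-- The index of the first difference `g (k + 1) r - g k r` of row `r` that covers the column `j`;
it is `0` if there is none. -/
noncomputable def entryOfPattern (g : ℕ → ℕ → ℕ) (r j : ℕ) : ℕ :=
  sInf {k | j < g (k + 1) r}

theorem Interlacing.entryOfPattern_lt_iff {g : ℕ → ℕ → ℕ} (hg : Interlacing g) {r j : ℕ}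
    (hinner : g 0 r ≤ j) {N : ℕ} (houter : j < g N r) (k : ℕ) :
    entryOfPattern g r j < k ↔ j < g k r := by
  have hspec : j < g (entryOfPattern g r j + 1) r :=
    Nat.sInf_mem (s := {k | j < g (k + 1) r}) ⟨N, houter.trans_le (hg.mono N r)⟩
  refine ⟨fun h => hspec.trans_le (hg.monotone r h), fun h => ?_⟩
  obtain _ | k := k
  · lia
  · exact Nat.lt_succ_of_le (Nat.sInf_le h)

namespace SkewSSYT

variable {T U : SkewSSYT} {r j k : ℕ}

theorem entry_le_of_le {i₁ i₂ j₁ j₂ : ℕ} (T : SkewSSYT) (hi : i₁ ≤ i₂) (hj : j₁ ≤ j₂)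
    (hinner : (i₁, j₁) ∉ T.inner) (houter : (i₂, j₂) ∈ T.outer) :
    T.entry i₁ j₁ ≤ T.entry i₂ j₂ := by
  have hrow : T.entry i₁ j₁ ≤ T.entry i₁ j₂ := by
    rcases hj.eq_or_lt with rfl | hj
    · exact le_rfl
    · exact T.row_weak _ _ _ hj hinner (T.outer.up_left_mem hi le_rfl houter)
  refine hrow.trans ?_
  rcases hi.eq_or_lt with rfl | hi
  · exact le_rfl
  · exact (T.col_strict _ _ _ hi (fun h => hinner (T.inner.up_left_mem le_rfl hj h)) houter).le

/-- The Young diagram formed by the inner shape and the squares with an entry less than `k`. -/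
def level (T : SkewSSYT) (k : ℕ) : YoungDiagram where
  cells := T.outer.cells.filter fun c => c ∈ T.inner ∨ T.entry c.1 c.2 < k
  isLowerSet := by
    rintro ⟨a, b⟩ ⟨c, d⟩ ⟨hca : c ≤ a, hdb : d ≤ b⟩ h
    simp only [Finset.coe_filter, YoungDiagram.mem_cells, Set.mem_ofPred_eq] at h ⊢
    refine ⟨T.outer.up_left_mem hca hdb h.1, or_iff_not_imp_left.2 fun hinner => ?_⟩
    exact (T.entry_le_of_le hca hdb hinner h.1).trans_lt
      (h.2.resolve_left fun h' => hinner (T.inner.up_left_mem hca hdb h'))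

/-- The chain of partitions encoded by a tableau, by row lengths: the `k`-th partition is formed by
the inner shape and the squares with an entry less than `k`. -/
def pattern (T : SkewSSYT) (k r : ℕ) : ℕ :=
  (T.level k).rowLen r

theorem mem_level_iff : (r, j) ∈ T.level k ↔ j < T.pattern k r :=
  YoungDiagram.mem_iff_lt_rowLen

theorem lt_pattern_iff :
    j < T.pattern k r ↔ (r, j) ∈ T.inner ∨ (r, j) ∈ T.outer ∧ T.entry r j < k := by
  have hsub : (r, j) ∈ T.inner → (r, j) ∈ T.outer := fun h => T.inner_le_outer h
  rw [← mem_level_iff, ← YoungDiagram.mem_cells]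
  simp only [level, Finset.mem_filter, YoungDiagram.mem_cells]
  tauto

theorem level_le_outer (T : SkewSSYT) (k : ℕ) : T.level k ≤ T.outer :=
  Finset.filter_subset _ _

theorem level_le_succ (T : SkewSSYT) (k : ℕ) : T.level k ≤ T.level (k + 1) := by
  rintro ⟨r, j⟩ h
  rw [mem_level_iff, lt_pattern_iff] at h ⊢
  exact h.imp_right fun h => ⟨h.1, h.2.trans (Nat.lt_succ_self k)⟩

theorem level_zero (T : SkewSSYT) : T.level 0 = T.inner := by
  ext ⟨r, j⟩
  simp [mem_level_iff, lt_pattern_iff]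

theorem mem_inner_iff : (r, j) ∈ T.inner ↔ j < T.pattern 0 r := by
  rw [← level_zero, mem_level_iff]

theorem exists_level_eq_outer (T : SkewSSYT) : ∃ N, ∀ k, N ≤ k → T.level k = T.outer := by
  refine ⟨(T.outer.cells.sup fun c => T.entry c.1 c.2) + 1, fun k hk => ?_⟩
  ext ⟨r, j⟩
  rw [YoungDiagram.mem_cells, YoungDiagram.mem_cells, mem_level_iff, lt_pattern_iff]
  refine ⟨fun h => h.elim (fun h => T.inner_le_outer h) And.left, fun h => Or.inr ⟨h, ?_⟩⟩
  have : T.entry r j ≤ T.outer.cells.sup fun c => T.entry c.1 c.2 :=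
    Finset.le_sup (f := fun c : ℕ × ℕ => T.entry c.1 c.2) h
  lia

theorem mem_outer_iff : (r, j) ∈ T.outer ↔ ∃ k, j < T.pattern k r := by
  simp only [lt_pattern_iff]
  refine ⟨fun h => ⟨T.entry r j + 1, Or.inr ⟨h, Nat.lt_succ_self _⟩⟩, ?_⟩
  rintro ⟨k, h | h⟩
  · exact T.inner_le_outer h
  · exact h.1

theorem isGTPattern_pattern (T : SkewSSYT) : IsGTPattern T.pattern where
  mono k r := le_of_forall_lt fun j => by
    rw [← mem_level_iff, ← mem_level_iff]
    exact @T.level_le_succ k (r, j)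
  interlace k r := by
    refine le_of_forall_lt fun j => ?_
    simp only [lt_pattern_iff]
    rintro (h | ⟨houter, hlt⟩)
    · exact Or.inl (T.inner.up_left_mem (Nat.le_succ r) le_rfl h)
    · refine or_iff_not_imp_left.2 fun hinner =>
        ⟨T.outer.up_left_mem (Nat.le_succ r) le_rfl houter, ?_⟩
      have := T.col_strict r (r + 1) j (Nat.lt_succ_self r) hinner houter
      lia
  bounded := by
    obtain ⟨N, hN⟩ := T.exists_level_eq_outer
    refine ⟨max N (T.outer.colLen 0), fun k hk => ?_, fun r hr => ?_⟩
    · funext r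
      rw [pattern, pattern, hN k (by lia), hN _ (le_max_left _ _)]
    · rw [pattern, hN _ (le_max_left _ _)]
      by_contra hpos
      have hmem : (r, 0) ∈ T.outer := YoungDiagram.mem_iff_lt_rowLen.2 (Nat.pos_of_ne_zero hpos)
      have := YoungDiagram.mem_iff_lt_colLen.1 hmem
      lia

theorem entry_lt_iff (hinner : (r, j) ∉ T.inner) (houter : (r, j) ∈ T.outer) :
    T.entry r j < k ↔ j < T.pattern k r := by
  rw [lt_pattern_iff]; tauto

theorem entry_congr {r' j' : ℕ} (h : ∀ k, j < T.pattern k r ↔ j' < U.pattern k r') :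
    T.entry r j = U.entry r' j' := by
  have hinner : (r, j) ∈ T.inner ↔ (r', j') ∈ U.inner := by simp only [mem_inner_iff, h]
  have houter : (r, j) ∈ T.outer ↔ (r', j') ∈ U.outer := by simp only [mem_outer_iff, h]
  by_cases hT : (r, j) ∈ T.outer ∧ (r, j) ∉ T.inner
  · have hU : (r', j') ∈ U.outer ∧ (r', j') ∉ U.inner := by rwa [← hinner, ← houter]
    refine eq_of_forall_gt_iff fun k => ?_
    rw [entry_lt_iff hT.2 hT.1, entry_lt_iff hU.2 hU.1, h]
  · rw [T.entry_eq_zero r j hT, U.entry_eq_zero r' j' (by rwa [← hinner, ← houter])]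

theorem pattern_injective : Function.Injective pattern := fun T U h => by
  apply SkewSSYT.ext
  · ext ⟨r, j⟩
    simp only [YoungDiagram.mem_cells, mem_outer_iff, h]
  · ext ⟨r, j⟩
    simp only [YoungDiagram.mem_cells, mem_inner_iff, h]
  · funext r j
    exact entry_congr fun k => by rw [h]

/-- The tableau with a given pattern. -/
noncomputable def ofPattern {g : ℕ → ℕ → ℕ} (hg : IsGTPattern g) : SkewSSYT where
  outer := rowDiagram (g hg.bounded.choose) (hg.antitone _)
    ⟨_, hg.bounded.choose_spec.2 _ le_rfl⟩
  inner := rowDiagram (g 0) (hg.antitone 0) ⟨hg.bounded.choose, Nat.eq_zero_of_le_zero <|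
    (hg.le_of_eventually_eq hg.bounded.choose_spec.1 0 _).trans_eq
      (hg.bounded.choose_spec.2 _ le_rfl)⟩
  inner_le_outer := by
    rintro ⟨r, j⟩ h
    rw [mem_rowDiagram] at h ⊢
    exact h.trans_le (hg.le_of_eventually_eq hg.bounded.choose_spec.1 0 r)
  entry := entryOfPattern g
  row_weak r j₁ j₂ hj hinner houter := by
    rw [mem_rowDiagram] at hinner houter
    have hlt := (hg.entryOfPattern_lt_iff (by lia) houter _).1 (Nat.lt_succ_self _)
    exact Nat.lt_succ_iff.1 <|
      (hg.entryOfPattern_lt_iff (by lia) (hj.trans houter) _).2 (hj.trans hlt)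
  col_strict r₁ r₂ j hr hinner houter := by
    rw [mem_rowDiagram] at hinner houter
    have hinner' : g 0 r₂ ≤ j := (hg.antitone 0 hr.le).trans (not_lt.1 hinner)
    have hlt := (hg.entryOfPattern_lt_iff hinner' houter _).1 (Nat.lt_succ_self _)
    exact (hg.entryOfPattern_lt_iff (by lia) (houter.trans_le (hg.antitone _ hr.le)) _).2 <|
      hlt.trans_le ((hg.antitone _ hr).trans (hg.interlace _ _))
  entry_eq_zero r j h := by
    rw [mem_rowDiagram, mem_rowDiagram] at h
    by_contra hne
    obtain ⟨k, hk⟩ : {k | j < g (k + 1) r}.Nonempty :=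
      Nat.nonempty_of_pos_sInf (Nat.pos_of_ne_zero hne)
    have houter := hk.trans_le (hg.le_of_eventually_eq hg.bounded.choose_spec.1 (k + 1) r)
    have hinner : j < g 0 r := by_contra fun hinner => h ⟨houter, hinner⟩
    exact hne (Nat.sInf_eq_zero.2 (Or.inl (hinner.trans_le (hg.mono 0 r))))

theorem pattern_ofPattern {g : ℕ → ℕ → ℕ} (hg : IsGTPattern g) : (ofPattern hg).pattern = g := by
  funext k r
  refine eq_of_forall_lt_iff fun j => ?_
  have houter := hg.le_of_eventually_eq hg.bounded.choose_spec.1 k r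
  have hinner := hg.monotone r (Nat.zero_le k)
  rw [lt_pattern_iff]
  simp only [ofPattern, mem_rowDiagram]
  by_cases h0 : j < g 0 r
  · simp only [h0, true_or, true_iff]
    exact h0.trans_le hinner
  · by_cases hN : j < g hg.bounded.choose r
    · rw [hg.entryOfPattern_lt_iff (by lia) hN]
      tauto
    · lia

end SkewSSYT

/-! ### Inward slides and patterns -/

namespace SkewSSYT

variable {T T' U : SkewSSYT} {r i j k : ℕ}

theorem entry_eq_of_mem_level (h : (i, j) ∉ T.level k) (h' : (i, j) ∈ T.level (k + 1)) :
    T.entry i j = k := by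
  rw [mem_level_iff, lt_pattern_iff] at h h'
  grind

theorem le_entry_of_notMem_level (h : (i, j) ∉ T.level k) (houter : (i, j) ∈ T.outer) :
    k ≤ T.entry i j := by
  rw [mem_level_iff, lt_pattern_iff] at h
  grind

/-- `T'` is obtained from `T` by a slide, in terms of patterns, into the corner of the inner shape
in row `r`. -/
structure PatternSlide (r : ℕ) (T T' : SkewSSYT) : Prop where
  corner : T.pattern 0 (r + 1) < T.pattern 0 r
  pattern_eq : T'.pattern = slidePattern T.pattern r

/-- The square removed from the `k`-th partition by the slide starting in row `r`. The empty square
of the slide passes through these squares. -/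
def slideSquare (T : SkewSSYT) (r k : ℕ) : ℕ × ℕ :=
  (slideRow T.pattern r k, T.pattern k (slideRow T.pattern r k) - 1)

theorem monotone_slideSquare (T : SkewSSYT) (r : ℕ) :
    Monotone fun k => toLex (T.slideSquare r k) := by
  refine monotone_nat_of_le_succ fun k => ?_
  rw [Prod.Lex.toLex_le_toLex]
  rcases slideRow_succ_cases T.pattern r k with ⟨-, e⟩ | ⟨-, e⟩
  · exact Or.inl (by simp [slideSquare, e])
  · exact Or.inr ⟨e.symm, by
      simpa [slideSquare, e] using Nat.sub_le_sub_right (T.isGTPattern_pattern.mono k _) 1⟩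

/-- The filling during a slide from `T` to `T'` when the empty square is `c`: the entries up to `c`
in lexicographic order are already in their final place. -/
def slideFilling (T T' : SkewSSYT) (c : ℕ × ℕ) (i j : ℕ) : ℕ :=
  if (i, j) = c then 0 else if toLex (i, j) < toLex c then T'.entry i j else T.entry i j

theorem slideFilling_of_lt {c : ℕ × ℕ} (h : toLex c < toLex (i, j)) :
    slideFilling T T' c i j = T.entry i j := by
  rw [slideFilling, if_neg (by rintro rfl; exact h.false), if_neg h.not_gt]

theorem moveEntry_slideFilling {c c' : ℕ × ℕ} (hlt : toLex c < toLex c')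
    (hmoved : T'.entry c.1 c.2 = T.entry c'.1 c'.2)
    (hbetween : ∀ i j, toLex c < toLex (i, j) → toLex (i, j) < toLex c' →
      T'.entry i j = T.entry i j) :
    moveEntry (slideFilling T T' c) c' c = slideFilling T T' c' := by
  funext i j
  have hsrc : slideFilling T T' c c'.1 c'.2 = T.entry c'.1 c'.2 := slideFilling_of_lt hlt
  rw [moveEntry, hsrc]
  unfold slideFilling
  rcases lt_trichotomy (toLex (i, j)) (toLex c) with h | h | h
  · have := h.trans hlt
    grind
  · obtain rfl : (i, j) = c := h
    grind
  · have := hbetween i j h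
    grind

namespace PatternSlide

theorem slideSquare_mem_level (h : PatternSlide r T T') (k : ℕ) :
    T.slideSquare r k ∈ T.level k := by
  have := T.isGTPattern_pattern.slideRow_corner h.corner k
  rw [slideSquare, mem_level_iff]
  lia

theorem cells_level (h : PatternSlide r T T') (k : ℕ) :
    (T'.level k).cells = (T.level k).cells.erase (T.slideSquare r k) := by
  ext ⟨i, j⟩
  have hadd := T.isGTPattern_pattern.slidePattern_add h.corner k i
  have hcorner := T.isGTPattern_pattern.slideRow_corner h.corner k
  rw [← h.pattern_eq] at hadd
  simp only [YoungDiagram.mem_cells, mem_level_iff, Finset.mem_erase, slideSquare, ne_eq,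
    Prod.mk.injEq]
  grind

protected theorem mem_level_iff (h : PatternSlide r T T') :
    (i, j) ∈ T'.level k ↔ (i, j) ≠ T.slideSquare r k ∧ (i, j) ∈ T.level k := by
  rw [← YoungDiagram.mem_cells, h.cells_level, Finset.mem_erase, YoungDiagram.mem_cells]

protected theorem entry_eq (h : PatternSlide r T T') (hij : ∀ k, (i, j) ≠ T.slideSquare r k) :
    T'.entry i j = T.entry i j :=
  entry_congr fun k => by
    rw [← SkewSSYT.mem_level_iff, ← SkewSSYT.mem_level_iff, h.mem_level_iff]
    exact and_iff_right (hij k)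

theorem entry_eq_of_between (h : PatternSlide r T T')
    (hlt : toLex (T.slideSquare r k) < toLex (i, j))
    (hlt' : toLex (i, j) < toLex (T.slideSquare r (k + 1))) : T'.entry i j = T.entry i j :=
  h.entry_eq fun l hl => by
    rw [hl] at hlt hlt'
    have h1 := (T.monotone_slideSquare r).reflect_lt hlt
    have h2 := (T.monotone_slideSquare r).reflect_lt hlt'
    lia

theorem slideMove_up (h : PatternSlide r T T')
    (hrow : slideRow T.pattern r (k + 1) = slideRow T.pattern r k + 1) :
    SlideMove T.outer (T.slideSquare r k, slideFilling T T' (T.slideSquare r k))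
      (T.slideSquare r (k + 1), slideFilling T T' (T.slideSquare r (k + 1))) := by
  have hcorner := T.isGTPattern_pattern.slideRow_corner h.corner k
  have hmem := h.slideSquare_mem_level k
  have hmem' := h.slideSquare_mem_level (k + 1)
  have hsquare : T.slideSquare r (k + 1) = ((T.slideSquare r k).1 + 1, (T.slideSquare r k).2) := by
    rcases slideRow_succ_cases T.pattern r k with ⟨heq, -⟩ | ⟨-, e⟩
    · simp only [slideSquare, hrow, heq]
    · lia
  have hlt : toLex (T.slideSquare r k) < toLex (T.slideSquare r (k + 1)) := by
    rw [hsquare, Prod.Lex.toLex_lt_toLex]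
    exact Or.inl (Nat.lt_succ_self _)
  have hbelow : ((T.slideSquare r k).1 + 1, (T.slideSquare r k).2) ∉ T.level k := by
    rw [SkewSSYT.mem_level_iff]
    simp only [slideSquare]
    lia
  have hright : ((T.slideSquare r k).1, (T.slideSquare r k).2 + 1) ∉ T.level k := by
    rw [SkewSSYT.mem_level_iff]
    simp only [slideSquare]
    lia
  have hentry : T.entry (T.slideSquare r (k + 1)).1 (T.slideSquare r (k + 1)).2 = k :=
    entry_eq_of_mem_level (hsquare ▸ hbelow) hmem'
  have hentry' : T'.entry (T.slideSquare r k).1 (T.slideSquare r k).2 = k :=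
    entry_eq_of_mem_level (fun hk => (h.mem_level_iff.1 hk).1 rfl)
      (h.mem_level_iff.2 ⟨fun he => hlt.ne (congrArg toLex he), level_le_succ T k hmem⟩)
  rw [← moveEntry_slideFilling hlt (hentry'.trans hentry.symm) fun i j => h.entry_eq_of_between]
  rw [hsquare] at hentry hmem' ⊢
  refine .up (T.slideSquare r k).1 (T.slideSquare r k).2 _ (level_le_outer T _ hmem')
    fun houter => ?_
  rw [slideFilling_of_lt (by simp [Prod.Lex.toLex_lt_toLex]),
    slideFilling_of_lt (by simp [Prod.Lex.toLex_lt_toLex]), hentry]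
  exact le_entry_of_notMem_level hright houter

theorem slideMove_left (h : PatternSlide r T T')
    (hrow : slideRow T.pattern r (k + 1) = slideRow T.pattern r k)
    (hj : (T.slideSquare r k).2 ≤ j) (hj' : j < (T.slideSquare r (k + 1)).2) :
    SlideMove T.outer ((slideRow T.pattern r k, j), slideFilling T T' (slideRow T.pattern r k, j))
      ((slideRow T.pattern r k, j + 1), slideFilling T T' (slideRow T.pattern r k, j + 1)) := by
  have hcorner := T.isGTPattern_pattern.slideRow_corner h.corner k
  have hint := T.isGTPattern_pattern.interlace k (slideRow T.pattern r k)
  have hcases := slideRow_succ_cases T.pattern r k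
  simp only [slideSquare, hrow] at hj hj'
  have hright : (slideRow T.pattern r k, j + 1) ∉ T.level k := by
    rw [SkewSSYT.mem_level_iff]; lia
  have hright' : (slideRow T.pattern r k, j + 1) ∈ T.level (k + 1) := by
    rw [SkewSSYT.mem_level_iff]; lia
  have hbelow : (slideRow T.pattern r k + 1, j) ∉ T.level (k + 1) := by
    rw [SkewSSYT.mem_level_iff]; lia
  have hentry : T.entry (slideRow T.pattern r k) (j + 1) = k :=
    entry_eq_of_mem_level hright hright'
  have hentry' : T'.entry (slideRow T.pattern r k) j = k := by
    refine entry_eq_of_mem_level ?_ ?_ <;>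
      rw [h.mem_level_iff, SkewSSYT.mem_level_iff, slideSquare, ne_eq, Prod.mk.injEq] <;> lia
  rw [← moveEntry_slideFilling (c := (slideRow T.pattern r k, j))
    (c' := (slideRow T.pattern r k, j + 1)) (by simp [Prod.Lex.toLex_lt_toLex])
    (hentry'.trans hentry.symm) fun a b hab hab' => by
      rw [Prod.Lex.toLex_lt_toLex] at hab hab'; lia]
  refine .left _ _ _ (level_le_outer T _ hright') fun houter => ?_
  rw [slideFilling_of_lt (by simp [Prod.Lex.toLex_lt_toLex]),
    slideFilling_of_lt (by simp [Prod.Lex.toLex_lt_toLex]), hentry]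
  exact le_entry_of_notMem_level hbelow houter

theorem reflTransGen_slideMove (h : PatternSlide r T T') (k : ℕ) :
    Relation.ReflTransGen (SlideMove T.outer)
      (T.slideSquare r 0, slideFilling T T' (T.slideSquare r 0))
      (T.slideSquare r k, slideFilling T T' (T.slideSquare r k)) := by
  induction k with
  | zero => exact .refl
  | succ k ih =>
    refine ih.trans ?_
    rcases slideRow_succ_cases T.pattern r k with ⟨-, e⟩ | ⟨-, e⟩
    · exact .single (h.slideMove_up e)
    · have hleft : ∀ j, (T.slideSquare r k).2 ≤ j → j ≤ (T.slideSquare r (k + 1)).2 →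
          Relation.ReflTransGen (SlideMove T.outer)
            (T.slideSquare r k, slideFilling T T' (T.slideSquare r k))
            ((slideRow T.pattern r k, j), slideFilling T T' (slideRow T.pattern r k, j)) := by
        intro j hj
        induction j, hj using Nat.le_induction with
        | base => exact fun _ => .refl
        | succ j hj ih => exact fun hj' => (ih (by lia)).tail (h.slideMove_left e hj hj')
      have hmono := T.isGTPattern_pattern.mono k (slideRow T.pattern r k)
      have hend : T.slideSquare r (k + 1) =
          (slideRow T.pattern r k, (T.slideSquare r (k + 1)).2) := by
        rw [← e]; rfl
      rw [hend]
      exact hleft _ (by simp only [slideSquare, e]; lia) le_rfl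

theorem slideFilling_first (h : PatternSlide r T T') :
    slideFilling T T' (T.slideSquare r 0) = T.entry := by
  funext i j
  unfold slideFilling
  split_ifs with heq hlt
  · have := h.slideSquare_mem_level 0
    rw [← heq, level_zero] at this
    exact (T.entry_eq_zero i j fun hij => hij.2 this).symm
  · refine h.entry_eq fun l hl => ?_
    rw [hl] at hlt
    exact absurd ((T.monotone_slideSquare r).reflect_lt hlt) (Nat.not_lt_zero l)
  · rfl

theorem slideFilling_last (h : PatternSlide r T T') {N : ℕ}
    (hT : ∀ k, N ≤ k → T.level k = T.outer) (hT' : T'.level N = T'.outer) :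
    slideFilling T T' (T.slideSquare r N) = T'.entry := by
  funext i j
  unfold slideFilling
  split_ifs with heq hlt
  · refine (T'.entry_eq_zero i j fun hmem => ?_).symm
    rw [← hT', h.mem_level_iff] at hmem
    exact hmem.1.1 heq
  · rfl
  · refine (h.entry_eq fun l hl => ?_).symm
    have hpattern : ∀ k, N ≤ k → T.pattern k = T.pattern N := fun k hk => by
      funext s
      rw [pattern, pattern, hT k hk, hT N le_rfl]
    rcases le_total l N with hl' | hl'
    · rw [hl] at heq hlt
      exact heq ((((T.monotone_slideSquare r) hl').lt_or_eq).resolve_left hlt)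
    · refine heq (hl.trans ?_)
      rw [slideSquare, slideSquare, hpattern l hl',
        T.isGTPattern_pattern.slideRow_eventually h.corner hpattern l hl']

end PatternSlide

/-- `T'` is obtained from `T` by an inward slide into the square `c`. -/
def SlidesInto (c : ℕ × ℕ) (T T' : SkewSSYT) : Prop :=
  ∃ d ∈ T.outer,
    T'.inner.cells = T.inner.cells.erase c ∧
    T'.outer.cells = T.outer.cells.erase d ∧
    (d.1 + 1, d.2) ∉ T.outer ∧ (d.1, d.2 + 1) ∉ T.outer ∧
    Relation.ReflTransGen (SlideMove T.outer) (c, T.entry) (d, T'.entry)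

theorem PatternSlide.slidesInto (h : PatternSlide r T T') :
    SlidesInto (T.slideSquare r 0) T T' := by
  obtain ⟨M, hM⟩ := T.exists_level_eq_outer
  obtain ⟨M', hM'⟩ := T'.exists_level_eq_outer
  obtain ⟨N, hN, hN'⟩ : ∃ N, (∀ k, N ≤ k → T.level k = T.outer) ∧ T'.level N = T'.outer :=
    ⟨max M M', fun k hk => hM k (by lia), hM' _ (le_max_right _ _)⟩
  have hcorner := T.isGTPattern_pattern.slideRow_corner h.corner N
  refine ⟨T.slideSquare r N, ?_, ?_, ?_, ?_, ?_, ?_⟩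
  · exact hN N le_rfl ▸ h.slideSquare_mem_level N
  · rw [← level_zero, ← level_zero, h.cells_level]
  · rw [← hN', ← hN N le_rfl, h.cells_level]
  · rw [← hN N le_rfl, mem_level_iff]
    simp only [slideSquare]
    lia
  · rw [← hN N le_rfl, mem_level_iff]
    simp only [slideSquare]
    lia
  · have hpath := h.reflTransGen_slideMove N
    rwa [h.slideFilling_first, h.slideFilling_last hN hN'] at hpath

theorem rightUnique_slideMove (D : YoungDiagram) : Relator.RightUnique (SlideMove D) := by
  intro a b c hb hc
  cases hb with
  | up i j f below le =>
    cases hc with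
    | up => rfl
    | left _ _ _ right lt => exact absurd (lt below) (not_lt.2 (le right))
  | left i j f right lt =>
    cases hc with
    | up _ _ _ below le => exact absurd (lt below) (not_lt.2 (le right))
    | left => rfl

theorem isNormal_slideMove {D : YoungDiagram} {d : ℕ × ℕ} {f : ℕ → ℕ → ℕ}
    (hbelow : (d.1 + 1, d.2) ∉ D) (hright : (d.1, d.2 + 1) ∉ D) :
    IsNormal (SlideMove D) (d, f) := by
  intro b hb
  cases hb with
  | up _ _ _ below => exact hbelow below
  | left _ _ _ right => exact hright right

theorem SlidesInto.unique {c : ℕ × ℕ} (h : SlidesInto c T T') (h' : SlidesInto c T U) :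
    T' = U := by
  obtain ⟨d, -, hinner, houter, hbelow, hright, hpath⟩ := h
  obtain ⟨d', -, hinner', houter', hbelow', hright', hpath'⟩ := h'
  obtain ⟨rfl, hentry⟩ := Prod.mk.inj <|
    isNormalFormOf_unique_of_rightUnique (rightUnique_slideMove T.outer)
      ⟨hpath, isNormal_slideMove hbelow hright⟩ ⟨hpath', isNormal_slideMove hbelow' hright'⟩
  apply SkewSSYT.ext
  · ext1; rw [houter, houter']
  · ext1; rw [hinner, hinner']
  · exact hentry

theorem patternSlide_ofPattern (hcorner : T.pattern 0 (r + 1) < T.pattern 0 r) :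
    PatternSlide r T (ofPattern (T.isGTPattern_pattern.slidePattern hcorner)) :=
  ⟨hcorner, pattern_ofPattern _⟩

theorem SlidesInto.corner {c : ℕ × ℕ} (hc : c ∈ T.inner) (h : SlidesInto c T T') :
    T.pattern 0 (c.1 + 1) < T.pattern 0 c.1 ∧ c = T.slideSquare c.1 0 := by
  obtain ⟨r, m⟩ := c
  obtain ⟨-, -, hinner, -⟩ := h
  have hmem : ∀ {i j}, (i, j) ∈ T'.inner ↔ (i, j) ≠ (r, m) ∧ (i, j) ∈ T.inner := fun {i j} => by
    rw [← YoungDiagram.mem_cells, hinner, Finset.mem_erase, YoungDiagram.mem_cells]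
  have hright : (r, m + 1) ∉ T.inner := fun h =>
    (hmem.1 (T'.inner.up_left_mem le_rfl (Nat.le_succ m) (hmem.2 ⟨by simp, h⟩))).1 rfl
  have hbelow : (r + 1, m) ∉ T.inner := fun h =>
    (hmem.1 (T'.inner.up_left_mem (Nat.le_succ r) le_rfl (hmem.2 ⟨by simp, h⟩))).1 rfl
  rw [mem_inner_iff] at hc hright hbelow
  exact ⟨by simp only; lia, by simp only [slideSquare, slideRow, Prod.mk.injEq]; lia⟩

theorem inwardSlide_iff : InwardSlide T T' ↔ ∃ r, PatternSlide r T T' := by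
  constructor
  · rintro ⟨c, hc, (h : SlidesInto c T T')⟩
    obtain ⟨hcorner, hsquare⟩ := SlidesInto.corner hc h
    have hslide := patternSlide_ofPattern hcorner
    rw [hsquare] at h
    rw [h.unique hslide.slidesInto]
    exact ⟨c.1, hslide⟩
  · rintro ⟨r, h⟩
    exact ⟨_, level_zero T ▸ h.slideSquare_mem_level 0, h.slidesInto⟩

end SkewSSYT

/-! ### Raising operations and patterns -/

section Words

variable {i : ℕ} {u v w : List ℕ}

theorem AntidominantFor.dominantFor_cons_append (hu : AntidominantFor i u)
    (hcount : u.count i = u.count (i + 1)) (hv : DominantFor i v) :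
    DominantFor i (i :: (u ++ (i + 1) :: v)) := by
  intro p hp
  rcases List.prefix_cons_iff.1 hp with rfl | ⟨q, rfl, hq⟩
  · simp
  rcases List.prefix_or_prefix_of_prefix hq (List.prefix_append _ _) with ⟨t, rfl⟩ | ⟨t, rfl⟩
  · have ht := hu t (List.suffix_append _ _)
    simp only [List.count_append] at hcount
    simp
    lia
  · rcases List.prefix_cons_iff.1 ((List.prefix_append_right_inj u).1 hq) with
      rfl | ⟨t, rfl, ht⟩
    · simp
      lia
    · have := hv t ht
      simp
      lia

theorem exists_eq_append_of_not_dominantFor (h : ¬ DominantFor i w) :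
    ∃ u v, w = u ++ (i + 1) :: v ∧ AntidominantFor i u ∧ DominantFor i v := by
  induction w with
  | nil => exact absurd (fun u hu => by simp [List.prefix_nil.1 hu]) h
  | cons a t ih =>
    by_cases ht : DominantFor i t
    · obtain rfl : a = i + 1 := by
        by_contra hne
        refine h fun p hp => ?_
        rcases List.prefix_cons_iff.1 hp with rfl | ⟨q, rfl, hq⟩
        · simp
        · rw [List.count_cons_of_ne hne]
          exact (ht q hq).trans List.count_le_count_cons
      exact ⟨[], t, rfl, fun u hu => by simp [List.suffix_nil.1 hu], ht⟩
    · obtain ⟨u, v, rfl, hu, hv⟩ := ih ht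
      refine ⟨a :: u, v, rfl, fun p hp => ?_, hv⟩
      rcases List.suffix_cons_iff.1 hp with rfl | hp
      · by_contra! hlt
        have hle := hu u List.suffix_rfl
        obtain rfl : a = i := by
          by_contra hne
          rw [List.count_cons_of_ne hne] at hlt
          exact hle.not_gt (List.count_le_count_cons.trans_lt hlt)
        refine h (hu.dominantFor_cons_append (hle.antisymm ?_) hv)
        simpa [Nat.lt_succ_iff] using hlt
      · exact hu p hp

/-- The number of letters `i` minus the number of letters `i + 1` of a word. -/
def excess (i : ℕ) (w : List ℕ) : ℤ :=
  w.count i - w.count (i + 1)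

theorem excess_nil (i : ℕ) : excess i [] = 0 :=
  rfl

theorem excess_append (i : ℕ) (u v : List ℕ) : excess i (u ++ v) = excess i u + excess i v := by
  simp only [excess, List.count_append]
  lia

theorem excess_cons_succ (i : ℕ) (w : List ℕ) : excess i ((i + 1) :: w) = excess i w - 1 := by
  simp [excess]
  lia

theorem DominantFor.excess_nonneg (h : DominantFor i w) (hu : u <+: w) : 0 ≤ excess i u := by
  have := h u hu
  rw [excess]
  lia

theorem AntidominantFor.excess_nonpos (h : AntidominantFor i w) (hu : u <:+ w) :
    excess i u ≤ 0 := by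
  have := h u hu
  rw [excess]
  lia

end Words

section RaiseRow

variable {g : ℕ → ℕ → ℕ} {i r : ℕ}

/-- Hence the first minimum of the height is attained in a row that contains a letter `i + 1`. -/
theorem Interlacing.height_le_succ_of_eq (hg : Interlacing g)
    (h : g (i + 1) (r + 1) = g (i + 2) (r + 1)) : height g i r ≤ height g i (r + 1) := by
  have := hg.mono i r
  rw [height_succ]
  lia

theorem Interlacing.exists_height_neg (hg : Interlacing g) (h : height g i r < 0) :
    ∃ s, g (i + 1) s < g (i + 2) s ∧ height g i s < 0 := by
  induction r with
  | zero =>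
    rw [height_zero] at h
    exact ⟨0, by lia, by rw [height_zero]; exact h⟩
  | succ r ih =>
    rcases (hg.mono (i + 1) (r + 1)).eq_or_lt with heq | hlt
    · exact ih ((hg.height_le_succ_of_eq heq).trans_lt h)
    · exact ⟨r + 1, hlt, h⟩

theorem Interlacing.isRaiseRow_of_forall (hg : Interlacing g) (hneg : height g i r < 0)
    (hlt : ∀ s, s < r → g (i + 1) s < g (i + 2) s → height g i r < height g i s)
    (hle : ∀ s, r < s → g (i + 1) s < g (i + 2) s → height g i r ≤ height g i s) :
    IsRaiseRow (height g i) r where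
  neg := hneg
  lt_of_lt s hs := by
    induction s with
    | zero =>
      rcases (hg.mono (i + 1) 0).eq_or_lt with heq | hstrict
      · rw [height_zero, heq]
        lia
      · exact hlt 0 hs hstrict
    | succ s ih =>
      rcases (hg.mono (i + 1) (s + 1)).eq_or_lt with heq | hstrict
      · exact (ih (by lia)).trans_le (hg.height_le_succ_of_eq heq)
      · exact hlt _ hs hstrict
  le_of_le s hs := by
    induction s, hs using Nat.le_induction with
    | base => exact le_rfl
    | succ s hs ih =>
      rcases (hg.mono (i + 1) (s + 1)).eq_or_lt with heq | hstrict
      · exact ih.trans (hg.height_le_succ_of_eq heq)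
      · exact hle _ (by lia) hstrict

end RaiseRow

namespace SkewSSYT

variable {T U : SkewSSYT} {r j i k : ℕ} {c p : ℕ × ℕ} {l₁ l₂ : List (ℕ × ℕ)}

theorem mem_cells_iff : c ∈ T.cells ↔ c ∈ T.outer ∧ c ∉ T.inner := by
  rw [cells, Finset.mem_sdiff, YoungDiagram.mem_cells, YoungDiagram.mem_cells]

theorem mem_cells_and_entry_eq_iff :
    (r, j) ∈ T.cells ∧ T.entry r j = k ↔ T.pattern k r ≤ j ∧ j < T.pattern (k + 1) r := by
  rw [mem_cells_iff, ← not_lt, lt_pattern_iff, lt_pattern_iff]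
  grind

theorem first_mem_cells (h : T.pattern k r < T.pattern (k + 1) r) :
    (r, T.pattern k r) ∈ T.cells :=
  (mem_cells_and_entry_eq_iff.2 ⟨le_rfl, h⟩).1

theorem entry_first (h : T.pattern k r < T.pattern (k + 1) r) :
    T.entry r (T.pattern k r) = k :=
  (mem_cells_and_entry_eq_iff.2 ⟨le_rfl, h⟩).2

/-- The squares with entry `k` in the first `n` rows of `T`. -/
def lettersAbove (T : SkewSSYT) (k n : ℕ) : Finset (ℕ × ℕ) :=
  T.cells.filter fun c => T.entry c.1 c.2 = k ∧ c.1 < n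

theorem mem_lettersAbove {n : ℕ} :
    (r, j) ∈ T.lettersAbove k n ↔ (T.pattern k r ≤ j ∧ j < T.pattern (k + 1) r) ∧ r < n := by
  rw [← mem_cells_and_entry_eq_iff, lettersAbove, Finset.mem_filter, and_assoc]

theorem card_lettersAbove (T : SkewSSYT) (k n : ℕ) : ((T.lettersAbove k n).card : ℤ) =
    ∑ s ∈ Finset.range n, ((T.pattern (k + 1) s : ℤ) - T.pattern k s) := by
  have hrow : ∀ s ∈ Finset.range n, (T.lettersAbove k n).filter (fun c => c.1 = s) =
      (Finset.Ico (T.pattern k s) (T.pattern (k + 1) s)).image (Prod.mk s) := by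
    rintro s hs
    ext ⟨r, j⟩
    rw [Finset.mem_range] at hs
    simp only [Finset.mem_filter, mem_lettersAbove, Finset.mem_image, Finset.mem_Ico,
      Prod.mk.injEq]
    constructor
    · rintro ⟨⟨hj, -⟩, rfl⟩
      exact ⟨j, hj, rfl, rfl⟩
    · rintro ⟨j, hj, rfl, rfl⟩
      exact ⟨⟨hj, hs⟩, rfl⟩
  rw [Finset.card_eq_sum_card_fiberwise (f := Prod.fst) (t := Finset.range n) fun c hc => by
    simpa using (mem_lettersAbove.1 hc).2, Nat.cast_sum]
  refine Finset.sum_congr rfl fun s hs => ?_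
  rw [hrow s hs, Finset.card_image_of_injective _ (Prod.mk_right_injective s), Nat.card_Ico,
    Nat.cast_sub (T.isGTPattern_pattern.mono k s)]

theorem count_readWord (T : SkewSSYT) {l : List (ℕ × ℕ)} (hl : l.Nodup) (k : ℕ) :
    (T.readWord l).count k = (l.toFinset.filter fun c => T.entry c.1 c.2 = k).card := by
  have hfilter : (l.toFinset.filter fun c => T.entry c.1 c.2 = k) =
      (l.filter fun c => T.entry c.1 c.2 = k).toFinset := by
    ext c
    simp
  rw [hfilter, List.toFinset_card_of_nodup (hl.filter _), readWord,
    List.count_eq_countP, List.countP_map, List.countP_eq_length_filter]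
  rfl

theorem readWord_append (T : SkewSSYT) (l l' : List (ℕ × ℕ)) :
    T.readWord (l ++ l') = T.readWord l ++ T.readWord l' :=
  List.map_append

theorem readWord_cons (T : SkewSSYT) (c : ℕ × ℕ) (l : List (ℕ × ℕ)) :
    T.readWord (c :: l) = T.entry c.1 c.2 :: T.readWord l :=
  rfl

namespace IsReadingOrder

theorem notMem_left (hs : T.IsReadingOrder (l₁ ++ p :: l₂)) (hrow : p.1 ≤ c.1)
    (hcol : c.2 ≤ p.2) : c ∉ l₁ := fun hc =>
  (List.pairwise_append.1 hs.2.2).2.2 c hc p List.mem_cons_self ⟨hrow, hcol⟩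

theorem mem_left (hs : T.IsReadingOrder (l₁ ++ p :: l₂)) (hc : c ∈ T.cells) (hne : c ≠ p)
    (hrow : c.1 ≤ p.1) (hcol : p.2 ≤ c.2) : c ∈ l₁ := by
  rw [← hs.2.1, List.mem_append, List.mem_cons] at hc
  refine hc.resolve_right fun hc => ?_
  exact (List.pairwise_cons.1 (List.pairwise_append.1 hs.2.2).2.1).1 c
    (hc.resolve_left hne) ⟨hrow, hcol⟩

theorem mem_right (hs : T.IsReadingOrder (l₁ ++ p :: l₂)) (hc : c ∈ T.cells) (hne : c ≠ p)
    (hrow : p.1 ≤ c.1) (hcol : c.2 ≤ p.2) : c ∈ l₂ := by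
  rw [← hs.2.1, List.mem_append, List.mem_cons] at hc
  exact (hc.resolve_left (hs.notMem_left hrow hcol)).resolve_left hne

theorem filter_eq_lettersAbove (hs : T.IsReadingOrder (l₁ ++ (r, T.pattern (i + 1) r) :: l₂)) :
    (l₁.toFinset.filter fun c => T.entry c.1 c.2 = i) = T.lettersAbove i r := by
  ext ⟨t, m⟩
  rw [Finset.mem_filter, List.mem_toFinset, mem_lettersAbove]
  constructor
  · rintro ⟨hmem, hentry⟩
    have hcell := mem_cells_and_entry_eq_iff.1 ⟨(hs.2.1 _).1 (List.mem_append_left _ hmem), hentry⟩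
    refine ⟨hcell, lt_of_not_ge fun hrow => hs.notMem_left hrow ?_ hmem⟩
    exact hcell.2.le.trans (T.isGTPattern_pattern.antitone _ hrow)
  · rintro ⟨hcell, hrow⟩
    have hmem := mem_cells_and_entry_eq_iff.2 hcell
    refine ⟨hs.mem_left hmem.1 (by grind) hrow.le ?_, hmem.2⟩
    exact ((T.isGTPattern_pattern.antitone _ hrow).trans
      (T.isGTPattern_pattern.interlace i t)).trans hcell.1

theorem insert_filter_eq_lettersAbove
    (hs : T.IsReadingOrder (l₁ ++ (r, T.pattern (i + 1) r) :: l₂))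
    (hr : T.pattern (i + 1) r < T.pattern (i + 2) r) :
    insert (r, T.pattern (i + 1) r) (l₁.toFinset.filter fun c => T.entry c.1 c.2 = i + 1) =
      T.lettersAbove (i + 1) (r + 1) := by
  ext ⟨t, m⟩
  rw [Finset.mem_insert, Finset.mem_filter, List.mem_toFinset, mem_lettersAbove]
  constructor
  · rintro (heq | ⟨hmem, hentry⟩)
    · obtain ⟨rfl, rfl⟩ := Prod.mk.inj heq
      exact ⟨⟨le_rfl, hr⟩, Nat.lt_succ_self _⟩
    · have hcell :=
        mem_cells_and_entry_eq_iff.1 ⟨(hs.2.1 _).1 (List.mem_append_left _ hmem), hentry⟩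
      refine ⟨hcell, lt_of_not_ge fun hrow => hs.notMem_left ((Nat.le_succ r).trans hrow) ?_ hmem⟩
      exact hcell.2.le.trans ((T.isGTPattern_pattern.antitone _ hrow).trans
        (T.isGTPattern_pattern.interlace (i + 1) r))
  · rintro ⟨hcell, hrow⟩
    have hmem := mem_cells_and_entry_eq_iff.2 hcell
    refine or_iff_not_imp_left.2 fun hne => ⟨hs.mem_left hmem.1 hne (Nat.lt_succ_iff.1 hrow) ?_,
      hmem.2⟩
    exact (T.isGTPattern_pattern.antitone _ (Nat.lt_succ_iff.1 hrow)).trans hcell.1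

/-- Up to the leftmost entry `i + 1` of a row, all valid reading orders read the same letters `i`
and `i + 1`. -/
theorem excess_readWord (hs : T.IsReadingOrder (l₁ ++ (r, T.pattern (i + 1) r) :: l₂))
    (hr : T.pattern (i + 1) r < T.pattern (i + 2) r) :
    excess i (T.readWord l₁) = height T.pattern i r + 1 := by
  have hnodup : l₁.Nodup := (List.nodup_append.1 hs.1).1
  have hnotMem : (r, T.pattern (i + 1) r) ∉ l₁ := hs.notMem_left le_rfl le_rfl
  rw [excess, T.count_readWord hnodup, T.count_readWord hnodup, hs.filter_eq_lettersAbove, height,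
    ← card_lettersAbove, ← card_lettersAbove, ← hs.insert_filter_eq_lettersAbove hr,
    Finset.card_insert_of_notMem (by simp [hnotMem])]
  lia

theorem height_lt_of_antidominantFor {t : ℕ}
    (hs : T.IsReadingOrder (l₁ ++ (r, T.pattern (i + 1) r) :: l₂))
    (hr : T.pattern (i + 1) r < T.pattern (i + 2) r) (hu : AntidominantFor i (T.readWord l₁))
    (htr : t < r) (ht : T.pattern (i + 1) t < T.pattern (i + 2) t) :
    height T.pattern i r < height T.pattern i t := by
  have hmem : (t, T.pattern (i + 1) t) ∈ l₁ := hs.mem_left (first_mem_cells ht)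
    (fun h => htr.ne (congrArg Prod.fst h)) htr.le (T.isGTPattern_pattern.antitone _ htr.le)
  obtain ⟨a, b, rfl⟩ := List.append_of_mem hmem
  have hexcess := hs.excess_readWord hr
  rw [List.append_assoc] at hs
  have hexcess' := hs.excess_readWord ht
  rw [readWord_append, excess_append, readWord_cons, entry_first ht, excess_cons_succ] at hexcess
  rw [readWord_append, readWord_cons] at hu
  have := hu.excess_nonpos ((List.suffix_cons _ _).trans (List.suffix_append _ _))
  lia

theorem height_le_of_dominantFor {t : ℕ}
    (hs : T.IsReadingOrder (l₁ ++ (r, T.pattern (i + 1) r) :: l₂))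
    (hr : T.pattern (i + 1) r < T.pattern (i + 2) r) (hv : DominantFor i (T.readWord l₂))
    (hrt : r < t) (ht : T.pattern (i + 1) t < T.pattern (i + 2) t) :
    height T.pattern i r ≤ height T.pattern i t := by
  have hmem : (t, T.pattern (i + 1) t) ∈ l₂ := hs.mem_right (first_mem_cells ht)
    (fun h => hrt.ne' (congrArg Prod.fst h)) hrt.le (T.isGTPattern_pattern.antitone _ hrt.le)
  obtain ⟨a, b, rfl⟩ := List.append_of_mem hmem
  have hexcess := hs.excess_readWord hr
  rw [← List.cons_append, ← List.append_assoc] at hs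
  have hexcess' := hs.excess_readWord ht
  rw [readWord_append, excess_append, readWord_cons, entry_first hr, excess_cons_succ] at hexcess'
  rw [readWord_append, readWord_cons, entry_first ht, List.append_cons] at hv
  have hnonneg := hv.excess_nonneg (List.prefix_append _ _)
  rw [excess_append, excess_cons_succ, excess_nil] at hnonneg
  lia

theorem isRaiseRow (hs : T.IsReadingOrder (l₁ ++ (r, T.pattern (i + 1) r) :: l₂))
    (hr : T.pattern (i + 1) r < T.pattern (i + 2) r) (hu : AntidominantFor i (T.readWord l₁))
    (hv : DominantFor i (T.readWord l₂)) : IsRaiseRow (height T.pattern i) r :=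
  T.isGTPattern_pattern.isRaiseRow_of_forall
    (by have := hs.excess_readWord hr; have := hu.excess_nonpos List.suffix_rfl; lia)
    (fun _ htr ht => hs.height_lt_of_antidominantFor hr hu htr ht)
    (fun _ hrt ht => hs.height_le_of_dominantFor hr hv hrt ht)

end IsReadingOrder

/-- The squares of `T` in the order in which `rowWord` reads them. -/
def rowCells (T : SkewSSYT) : List (ℕ × ℕ) :=
  (List.range (T.outer.colLen 0)).flatMap fun i =>
    (List.range' (T.inner.rowLen i) (T.outer.rowLen i - T.inner.rowLen i)).reverse.map (Prod.mk i)

theorem readWord_rowCells (T : SkewSSYT) : T.readWord T.rowCells = T.rowWord := by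
  simp [readWord, rowCells, rowWord, List.map_flatMap, Function.comp_def]

theorem mem_rowCells : c ∈ T.rowCells ↔ c ∈ T.cells := by
  obtain ⟨r, j⟩ := c
  have hcol : (r, j) ∈ T.outer → r < T.outer.colLen 0 := fun h =>
    YoungDiagram.mem_iff_lt_colLen.1 (T.outer.up_left_mem le_rfl (Nat.zero_le j) h)
  rw [mem_cells_iff]
  simp only [rowCells, List.mem_flatMap, List.mem_range, List.mem_map, List.mem_reverse,
    List.mem_range'_1, Prod.mk.injEq, YoungDiagram.mem_iff_lt_rowLen] at hcol ⊢
  constructor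
  · rintro ⟨s, -, m, hm, rfl, rfl⟩
    lia
  · rintro ⟨houter, hinner⟩
    exact ⟨r, hcol houter, j, by lia, rfl, rfl⟩

theorem pairwise_rowCells (T : SkewSSYT) :
    T.rowCells.Pairwise fun a b => a.1 < b.1 ∨ a.1 = b.1 ∧ b.2 < a.2 := by
  rw [rowCells, List.pairwise_flatMap]
  constructor
  · intro i _
    rw [List.pairwise_map, List.pairwise_reverse]
    exact (List.pairwise_lt_range' 1 Nat.one_pos).imp fun h => Or.inr ⟨rfl, h⟩
  · refine List.pairwise_lt_range.imp fun h => ?_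
    simp only [List.mem_map]
    rintro _ ⟨a, -, rfl⟩ _ ⟨b, -, rfl⟩
    exact Or.inl h

theorem isReadingOrder_rowCells (T : SkewSSYT) : T.IsReadingOrder T.rowCells :=
  ⟨T.pairwise_rowCells.imp fun h => by rintro rfl; lia, fun _ => mem_rowCells,
    T.pairwise_rowCells.imp fun h => by lia⟩

/-- Otherwise the next letter of the row word would be another `i + 1`. -/
theorem eq_pattern_of_rowCells_eq (hs : T.rowCells = l₁ ++ (r, j) :: l₂)
    (hentry : T.entry r j = i + 1) (hv : DominantFor i (T.readWord l₂)) :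
    j = T.pattern (i + 1) r := by
  have hcell : (r, j) ∈ T.cells := mem_rowCells.1 (by simp [hs])
  obtain ⟨hle, hlt⟩ := mem_cells_and_entry_eq_iff.1 ⟨hcell, hentry⟩
  by_contra hne
  obtain ⟨hcell', hentry'⟩ := (mem_cells_and_entry_eq_iff (T := T) (r := r) (j := j - 1)
    (k := i + 1)).2 ⟨by lia, by lia⟩
  have hmem : (r, j - 1) ∈ l₂ := (hs ▸ T.isReadingOrder_rowCells).mem_right hcell'
    (by simp only [ne_eq, Prod.mk.injEq]; lia) le_rfl (Nat.sub_le j 1)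
  obtain ⟨a, b, rfl⟩ := List.append_of_mem hmem
  obtain rfl : a = [] := by
    have hpairwise := T.pairwise_rowCells
    rw [hs, List.pairwise_append, List.pairwise_cons, List.pairwise_append] at hpairwise
    obtain ⟨-, ⟨hafter, -, -, hbefore⟩, -⟩ := hpairwise
    refine List.eq_nil_iff_forall_not_mem.2 fun c hc => ?_
    have h1 := hafter c (List.mem_append_left _ hc)
    have h2 := hbefore c hc _ List.mem_cons_self
    lia
  have := hv [i + 1] (by simp [readWord_cons, hentry'])
  simp at this

theorem exists_rowCells_eq_of_not_dominantFor (h : ¬ DominantFor i T.rowWord) :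
    ∃ r l₁ l₂, T.rowCells = l₁ ++ (r, T.pattern (i + 1) r) :: l₂ ∧
      T.pattern (i + 1) r < T.pattern (i + 2) r ∧
      AntidominantFor i (T.readWord l₁) ∧ DominantFor i (T.readWord l₂) := by
  obtain ⟨u, v, hword, hu, hv⟩ := exists_eq_append_of_not_dominantFor h
  rw [← readWord_rowCells] at hword
  obtain ⟨l₁, l, hs, rfl, hl⟩ := List.map_eq_append_iff.1 hword
  obtain ⟨⟨r, j⟩, l₂, rfl, hentry, rfl⟩ := List.map_eq_cons_iff.1 hl
  obtain rfl := eq_pattern_of_rowCells_eq hs hentry hv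
  have hcell : (r, T.pattern (i + 1) r) ∈ T.cells := mem_rowCells.1 (by simp [hs])
  exact ⟨r, l₁, l₂, hs, (mem_cells_and_entry_eq_iff.1 ⟨hcell, hentry⟩).2, hu, hv⟩

theorem dominantFor_rowWord_iff :
    DominantFor i T.rowWord ↔ ∀ r, 0 ≤ height T.pattern i r := by
  constructor
  · intro h r
    by_contra! hneg
    obtain ⟨s, hs, hneg⟩ := T.isGTPattern_pattern.exists_height_neg hneg
    obtain ⟨l₁, l₂, hcells⟩ := List.append_of_mem (mem_rowCells.2 (first_mem_cells hs))
    have hexcess := (hcells ▸ T.isReadingOrder_rowCells).excess_readWord hs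
    rw [← readWord_rowCells, hcells, readWord_append, readWord_cons, entry_first hs,
      List.append_cons] at h
    have hnonneg := h.excess_nonneg (List.prefix_append _ _)
    rw [excess_append, excess_cons_succ, excess_nil] at hnonneg
    lia
  · intro h
    by_contra hdom
    obtain ⟨r, l₁, l₂, hs, hr, hu, hv⟩ := exists_rowCells_eq_of_not_dominantFor hdom
    exact absurd (h r) ((hs ▸ T.isReadingOrder_rowCells).isRaiseRow hr hu hv).neg.not_ge

theorem isLittlewoodRichardson_iff :
    T.IsLittlewoodRichardson ↔ ∀ i r, 0 ≤ height T.pattern i r := by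
  simp only [← dominantFor_rowWord_iff]
  exact ⟨fun h i u hu => h u hu i, fun h u hu i => h i u hu⟩

theorem level_eq_of_pattern_eq_raiseAt (h : U.pattern = raiseAt T.pattern i r)
    (hk : k ≠ i + 1) : U.level k = T.level k := by
  ext ⟨s, j⟩
  rw [YoungDiagram.mem_cells, YoungDiagram.mem_cells, mem_level_iff, mem_level_iff, h,
    raiseAt_of_ne hk]

theorem outer_eq_of_pattern_eq_raiseAt (h : U.pattern = raiseAt T.pattern i r) :
    U.outer = T.outer := by
  obtain ⟨M, hM⟩ := T.exists_level_eq_outer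
  obtain ⟨N, hN⟩ := U.exists_level_eq_outer
  rw [← hM (max (max M N) (i + 2)) (by lia), ← hN (max (max M N) (i + 2)) (by lia)]
  exact level_eq_of_pattern_eq_raiseAt h (by lia)

theorem pattern_eq_raiseAt_iff (hr : T.pattern (i + 1) r < T.pattern (i + 2) r) :
    U.pattern = raiseAt T.pattern i r ↔ U.outer = T.outer ∧ U.inner = T.inner ∧
      U.entry r (T.pattern (i + 1) r) = i ∧
      ∀ s j, (s, j) ≠ (r, T.pattern (i + 1) r) → U.entry s j = T.entry s j := by
  constructor
  · intro h
    refine ⟨outer_eq_of_pattern_eq_raiseAt h, ?_, ?_, fun s j hne => entry_congr fun k => ?_⟩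
    · rw [← level_zero, ← level_zero, level_eq_of_pattern_eq_raiseAt h (Nat.succ_ne_zero i).symm]
    · refine entry_eq_of_mem_level ?_ ?_ <;> rw [mem_level_iff, h]
      · have := T.isGTPattern_pattern.mono i r
        simp only [raiseAt]
        lia
      · simp [raiseAt]
    · simp only [h, raiseAt]
      grind
  · rintro ⟨houter, hinner, hentry, hother⟩
    have hfirst := mem_cells_iff.1 (first_mem_cells hr)
    have hentry' := entry_first hr
    funext k s
    refine eq_of_forall_lt_iff fun j => ?_
    have hT := lt_pattern_iff (T := T) (r := s) (j := j) (k := k)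
    have hU := lt_pattern_iff (T := U) (r := s) (j := j) (k := k)
    simp only [raiseAt]
    rw [houter, hinner] at hU
    by_cases hne : (s, j) = (r, T.pattern (i + 1) r)
    · grind
    · rw [hother s j hne, ← hT] at hU
      grind

theorem Raises.raisesPattern (h : Raises i T U) : RaisesPattern i T.pattern U.pattern := by
  obtain ⟨houter, hinner, s, hs, u, v, hT, hU, hu, hv⟩ := h
  obtain ⟨l₁, l, rfl, rfl, hl⟩ := List.map_eq_append_iff.1 hT
  obtain ⟨⟨r, j⟩, l₂, rfl, hentry, rfl⟩ := List.map_eq_cons_iff.1 hl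
  obtain ⟨hleft, hright⟩ := List.append_inj ((U.readWord_append _ _).symm.trans hU)
    (by simp [readWord])
  obtain ⟨hentryU, hright⟩ := List.cons.inj hright
  have hother : ∀ s m, (s, m) ≠ (r, j) → U.entry s m = T.entry s m := fun s m hne => by
    by_cases hmem : (s, m) ∈ T.cells
    · rw [← hs.2.1, List.mem_append, List.mem_cons] at hmem
      rcases hmem with hmem | hmem | hmem
      · exact List.map_inj_left.1 hleft _ hmem
      · exact absurd hmem hne
      · exact List.map_inj_left.1 hright _ hmem
    · rw [mem_cells_iff] at hmem
      rw [T.entry_eq_zero s m hmem, U.entry_eq_zero s m (by rwa [houter, hinner])]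
  have hcell : (r, j) ∈ T.cells := (hs.2.1 _).1 (by simp)
  obtain ⟨hle, hlt⟩ := mem_cells_and_entry_eq_iff.1 ⟨hcell, hentry⟩
  obtain rfl : j = T.pattern (i + 1) r := by
    by_contra hne
    have hfirst := first_mem_cells (hle.trans_lt hlt)
    have hweak := U.row_weak r (T.pattern (i + 1) r) j (by lia)
      (hinner ▸ (mem_cells_iff.1 hfirst).2) (houter ▸ (mem_cells_iff.1 hcell).1)
    rw [hother _ _ (by simpa using Ne.symm hne), entry_first (hle.trans_lt hlt)] at hweak
    simp only [hentryU] at hweak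
    lia
  exact ⟨r, hs.isRaiseRow hlt hu hv,
    (pattern_eq_raiseAt_iff hlt).2 ⟨houter, hinner, hentryU, hother⟩⟩

theorem raises_iff : Raises i T U ↔ RaisesPattern i T.pattern U.pattern := by
  refine ⟨Raises.raisesPattern, ?_⟩
  rintro ⟨r', hr', hpattern⟩
  obtain ⟨r, l₁, l₂, hs, hr, hu, hv⟩ := exists_rowCells_eq_of_not_dominantFor (T := T) (i := i)
    fun h => hr'.neg.not_ge (dominantFor_rowWord_iff.1 h r')
  have horder := T.isReadingOrder_rowCells
  rw [hs] at horder
  obtain rfl := hr'.unique (horder.isRaiseRow hr hu hv)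
  obtain ⟨houter, hinner, hentry, hother⟩ := (pattern_eq_raiseAt_iff hr).1 hpattern
  have hread : ∀ l, (r', T.pattern (i + 1) r') ∉ l → U.readWord l = T.readWord l := fun l hl =>
    List.map_congr_left fun c hc => hother c.1 c.2 fun h => hl (h ▸ hc)
  have hnodup := List.nodup_middle.1 horder.1
  rw [List.nodup_cons, List.mem_append, not_or] at hnodup
  refine ⟨houter, hinner, _, horder, T.readWord l₁, T.readWord l₂, ?_, ?_, hu, hv⟩
  · rw [readWord_append, readWord_cons, entry_first hr]
  · rw [readWord_append, readWord_cons, hentry, hread _ hnodup.1.1, hread _ hnodup.1.2]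

theorem isNormal_raisingStep_iff : IsNormal RaisingStep T ↔ T.IsLittlewoodRichardson := by
  rw [isLittlewoodRichardson_iff]
  constructor
  · intro h i
    by_contra hneg
    rw [← dominantFor_rowWord_iff] at hneg
    obtain ⟨r, l₁, l₂, hs, hr, hu, hv⟩ := exists_rowCells_eq_of_not_dominantFor hneg
    have hrow := (hs ▸ T.isReadingOrder_rowCells).isRaiseRow hr hu hv
    exact h (ofPattern (T.isGTPattern_pattern.raiseAt hrow))
      ⟨i, raises_iff.2 ⟨r, hrow, pattern_ofPattern _⟩⟩
  · rintro h U ⟨i, hraises⟩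
    obtain ⟨r, hr, -⟩ := raises_iff.1 hraises
    exact hr.neg.not_ge (h i r)

end SkewSSYT

/-! ### Normal forms -/

namespace SkewSSYT

variable {T T' U U' : SkewSSYT} {r i : ℕ}

theorem isYoung_iff : T.IsYoung ↔ ∀ r, T.pattern 0 r = 0 := by
  rw [IsYoung, YoungDiagram.ext_iff, Finset.ext_iff]
  simp only [Prod.forall, YoungDiagram.mem_cells, mem_inner_iff, YoungDiagram.cells_bot,
    Finset.notMem_empty, iff_false, not_lt]
  exact forall_congr' fun r =>
    ⟨fun h => Nat.eq_zero_of_le_zero (h 0), fun h j => h.le.trans j.zero_le⟩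

theorem exists_corner (h : ¬ T.IsYoung) : ∃ r, T.pattern 0 (r + 1) < T.pattern 0 r := by
  by_contra! hmono
  refine h (isYoung_iff.2 fun r => ?_)
  obtain ⟨N, hN, hzero⟩ := T.isGTPattern_pattern.bounded
  have h1 := monotone_nat_of_le_succ hmono (le_max_left r N)
  have h2 := T.isGTPattern_pattern.le_of_eventually_eq hN 0 (max r N)
  rw [hzero _ (le_max_right r N)] at h2
  lia

theorem isNormal_inwardSlide_iff : IsNormal InwardSlide T ↔ T.IsYoung := by
  constructor
  · intro h
    by_contra hT
    obtain ⟨r, hr⟩ := exists_corner hT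
    exact h _ (inwardSlide_iff.2 ⟨r, patternSlide_ofPattern hr⟩)
  · rintro hT T' ⟨c, hc, -⟩
    rw [show T.inner = ⊥ from hT] at hc
    exact YoungDiagram.notMem_bot c hc

theorem PatternSlide.card_level (h : PatternSlide r T T') (k : ℕ) :
    (T'.level k).card + 1 = (T.level k).card := by
  rw [YoungDiagram.card, h.cells_level]
  exact Finset.card_erase_add_one (h.slideSquare_mem_level k)

theorem exists_isNormalFormOf_inwardSlide (T : SkewSSYT) :
    ∃ P, IsNormalFormOf InwardSlide P T := by
  refine exists_isNormalFormOf_of_measure (fun T => (T.level 0).card) (fun T T' h => ?_) T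
  obtain ⟨r, hr⟩ := inwardSlide_iff.1 h
  have := hr.card_level 0
  lia

theorem Raises.sum_entry_lt (h : Raises i T U) :
    ∑ c ∈ U.outer.cells, U.entry c.1 c.2 < ∑ c ∈ T.outer.cells, T.entry c.1 c.2 := by
  obtain ⟨r, hr, hpattern⟩ := raises_iff.1 h
  have hlt := (T.isGTPattern_pattern.lt_of_isRaiseRow hr).1
  obtain ⟨houter, -, hentry, hother⟩ := (pattern_eq_raiseAt_iff hlt).1 hpattern
  rw [houter]
  have hfirst : U.entry r (T.pattern (i + 1) r) < T.entry r (T.pattern (i + 1) r) := by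
    rw [hentry, entry_first hlt]
    exact Nat.lt_succ_self i
  refine Finset.sum_lt_sum (fun c _ => ?_) ⟨_, (mem_cells_iff.1 (first_mem_cells hlt)).1, hfirst⟩
  by_cases hc : c = (r, T.pattern (i + 1) r)
  · rw [hc]
    exact hfirst.le
  · exact (hother c.1 c.2 hc).le

theorem exists_isNormalFormOf_raisingStep (T : SkewSSYT) :
    ∃ L, IsNormalFormOf RaisingStep L T :=
  exists_isNormalFormOf_of_measure (fun T => ∑ c ∈ T.outer.cells, T.entry c.1 c.2)
    (fun _ _ ⟨_, h⟩ => h.sum_entry_lt) T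

/-! ### Slides and raising operations commute -/

/-- A slide labelled by the row in which it starts and by the outer shape to which it applies. These
data make it possible to undo the slide. -/
def SlideFrom (x : ℕ × YoungDiagram) (T T' : SkewSSYT) : Prop :=
  T.outer = x.2 ∧ PatternSlide x.1 T T'

theorem step_slideFrom : Step SlideFrom = InwardSlide := by
  funext T T'
  rw [inwardSlide_iff]
  exact propext ⟨fun ⟨x, h⟩ => ⟨x.1, h.2⟩, fun ⟨r, h⟩ => ⟨(r, T.outer), rfl, h⟩⟩

theorem leftUnique_slideFrom (x : ℕ × YoungDiagram) : Relator.LeftUnique (SlideFrom x) := by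
  rintro T T' U ⟨houter, h⟩ ⟨houter', h'⟩
  obtain ⟨M, hM⟩ := T.exists_level_eq_outer
  obtain ⟨N, hN⟩ := T'.exists_level_eq_outer
  refine pattern_injective (T.isGTPattern_pattern.slidePattern_injective
    T'.isGTPattern_pattern.toInterlacing h.corner h'.corner (h.pattern_eq.symm.trans h'.pattern_eq)
    (Filter.eventually_atTop.2 ⟨max M N, fun k hk => ?_⟩))
  funext r
  rw [pattern, pattern, hM k (by lia), hN k (by lia), houter, houter']

theorem leftUnique_raises (i : ℕ) : Relator.LeftUnique (Raises i) := fun _ _ _ h h' =>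
  pattern_injective (leftUnique_raisesPattern i (raises_iff.1 h) (raises_iff.1 h'))

theorem Raises.pattern_zero (h : Raises i T U) : U.pattern 0 = T.pattern 0 := by
  funext r
  rw [pattern, pattern, level_zero, level_zero, h.2.1]

theorem Raises.raises_of_patternSlide (h : Raises i T U) (hT : PatternSlide r T T')
    (hU : PatternSlide r U U') : Raises i T' U' := by
  rw [raises_iff, hT.pattern_eq, hU.pattern_eq]
  exact T.isGTPattern_pattern.raisesPattern_slidePattern hT.corner (raises_iff.1 h)

theorem diamond_slideFrom_raises (x : ℕ × YoungDiagram) (i : ℕ) :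
    Diamond (SlideFrom x) (Raises i) := fun _ _ _ ⟨houter, hslide⟩ hraises =>
  have hslide' := patternSlide_ofPattern (hraises.pattern_zero ▸ hslide.corner)
  ⟨_, hraises.raises_of_patternSlide hslide hslide', hraises.1.trans houter, hslide'⟩

theorem diamond_slideFrom_flip_raises (x : ℕ × YoungDiagram) (i : ℕ) :
    Diamond (SlideFrom x) (flip (Raises i)) := fun _ _ _ ⟨houter, hslide⟩ (hraises : Raises ..) =>
  have hslide' := patternSlide_ofPattern (hraises.pattern_zero ▸ hslide.corner)
  ⟨_, hraises.raises_of_patternSlide hslide' hslide, hraises.1.symm.trans houter, hslide'⟩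

theorem Raises.isYoung (h : Raises i T U) (hT : T.IsYoung) : U.IsYoung :=
  h.2.1.trans hT

theorem PatternSlide.isLittlewoodRichardson (h : PatternSlide r T T')
    (hT : T.IsLittlewoodRichardson) : T'.IsLittlewoodRichardson := by
  rw [isLittlewoodRichardson_iff] at hT ⊢
  intro i
  rw [h.pattern_eq]
  exact T.isGTPattern_pattern.height_slidePattern_nonneg h.corner (hT i)

end SkewSSYT

/-! ### Littlewood-Richardson tableaux of partition shape -/

theorem Interlacing.eq_zero_of_le {g : ℕ → ℕ → ℕ} (hg : Interlacing g) (hzero : ∀ r, g 0 r = 0)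
    {k r : ℕ} (h : k ≤ r) : g k r = 0 := by
  induction k generalizing r with
  | zero => exact hzero r
  | succ k ih =>
    obtain ⟨r, rfl⟩ := Nat.exists_eq_succ_of_ne_zero (by lia : r ≠ 0)
    exact Nat.eq_zero_of_le_zero (ih (r := r) (by lia) ▸ hg.interlace k r)

/-- A letter `i + 1` in a row `r ≤ i` would be preceded by a letter `i` in a row above it. -/
theorem Interlacing.succ_eq_of_height_nonneg {g : ℕ → ℕ → ℕ} (hg : Interlacing g)
    (hheight : ∀ i r, 0 ≤ height g i r) {k r : ℕ} (h : r < k) : g (k + 1) r = g k r := by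
  induction k generalizing r with
  | zero => exact absurd h (Nat.not_lt_zero r)
  | succ i ih =>
    have habove : ∑ s ∈ Finset.range r, ((g (i + 1) s : ℤ) - g i s) = 0 :=
      Finset.sum_eq_zero fun s hs => by
        rw [ih (by have := Finset.mem_range.1 hs; lia), sub_self]
    have hrow := Finset.single_le_sum (s := Finset.range (r + 1))
      (f := fun s => (g (i + 2) s : ℤ) - g (i + 1) s)
      (fun s _ => by have := hg.mono (i + 1) s; lia) (Finset.self_mem_range_succ r)
    have hr := hheight i r
    rw [height, habove] at hr
    have := hg.mono (i + 1) r
    lia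

namespace SkewSSYT

variable {T U P Q : SkewSSYT}

/-- All entries in row `r` are equal to `r`. -/
theorem IsLittlewoodRichardson.mem_level_iff (hT : T.IsLittlewoodRichardson) (hyoung : T.IsYoung)
    {k r j : ℕ} : (r, j) ∈ T.level k ↔ (r, j) ∈ T.outer ∧ r < k := by
  rw [SkewSSYT.mem_level_iff, mem_outer_iff]
  rcases lt_or_ge r k with hr | hr
  · have hconst : ∀ l, k ≤ l → T.pattern l r = T.pattern k r := fun l hl => by
      induction l, hl using Nat.le_induction with
      | base => rfl
      | succ l hl ih =>
        rw [T.isGTPattern_pattern.succ_eq_of_height_nonneg (isLittlewoodRichardson_iff.1 hT)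
          (hr.trans_le hl), ih]
    refine ⟨fun h => ⟨⟨k, h⟩, hr⟩, fun ⟨⟨l, hl⟩, _⟩ => ?_⟩
    rw [← hconst (max k l) (le_max_left k l)]
    exact hl.trans_le (T.isGTPattern_pattern.monotone r (le_max_right k l))
  · simp [T.isGTPattern_pattern.eq_zero_of_le (isYoung_iff.1 hyoung) hr, hr.not_gt]

theorem IsLittlewoodRichardson.eq_of_outer_eq (hT : T.IsLittlewoodRichardson)
    (hTyoung : T.IsYoung) (hU : U.IsLittlewoodRichardson) (hUyoung : U.IsYoung)
    (houter : T.outer = U.outer) : T = U := by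
  refine pattern_injective (funext₂ fun k r => eq_of_forall_lt_iff fun j => ?_)
  rw [← SkewSSYT.mem_level_iff, ← SkewSSYT.mem_level_iff, hT.mem_level_iff hTyoung,
    hU.mem_level_iff hUyoung, houter]

theorem IsLittlewoodRichardson.card_level_succ (hT : T.IsLittlewoodRichardson)
    (hyoung : T.IsYoung) (k : ℕ) :
    (T.level (k + 1)).card = (T.level k).card + T.outer.rowLen k := by
  have hcells : (T.level (k + 1)).cells = (T.level k).cells ∪ T.outer.row k := by
    ext ⟨r, j⟩
    simp only [YoungDiagram.mem_cells, Finset.mem_union, hT.mem_level_iff hyoung,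
      YoungDiagram.mem_row_iff]
    grind
  rw [YoungDiagram.card, hcells, Finset.card_union_of_disjoint, YoungDiagram.rowLen_eq_card]
  refine Finset.disjoint_left.2 fun c hc hc' => ?_
  obtain ⟨r, j⟩ := c
  have := ((hT.mem_level_iff hyoung).1 hc).2
  have := (YoungDiagram.mem_row_iff.1 hc').2
  lia

theorem IsLittlewoodRichardson.eq_of_card_level_eq (hT : T.IsLittlewoodRichardson)
    (hTyoung : T.IsYoung) (hU : U.IsLittlewoodRichardson) (hUyoung : U.IsYoung)
    (hcard : ∀ k, (T.level k).card = (U.level k).card) : T = U := by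
  refine hT.eq_of_outer_eq hTyoung hU hUyoung ?_
  ext ⟨r, j⟩
  have := hT.card_level_succ hTyoung r
  have := hU.card_level_succ hUyoung r
  have := hcard r
  have := hcard (r + 1)
  rw [YoungDiagram.mem_cells, YoungDiagram.mem_cells, YoungDiagram.mem_iff_lt_rowLen,
    YoungDiagram.mem_iff_lt_rowLen]
  lia

/-! ### Uniqueness of normal forms -/

theorem card_level_of_reflTransGen_inwardSlide (h : Relation.ReflTransGen InwardSlide T P)
    (k : ℕ) : (P.level k).card + T.inner.card = (T.level k).card + P.inner.card := by
  induction h with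
  | refl => rfl
  | tail _ hslide ih =>
    obtain ⟨r, hr⟩ := inwardSlide_iff.1 hslide
    have := hr.card_level k
    have := hr.card_level 0
    rw [level_zero, level_zero] at this
    lia

theorem IsLittlewoodRichardson.of_reflTransGen_inwardSlide (hT : T.IsLittlewoodRichardson)
    (h : Relation.ReflTransGen InwardSlide T P) : P.IsLittlewoodRichardson := by
  induction h with
  | refl => exact hT
  | tail _ hslide ih =>
    obtain ⟨r, hr⟩ := inwardSlide_iff.1 hslide
    exact hr.isLittlewoodRichardson ih

theorem IsLittlewoodRichardson.inwardSlide_unique (hT : T.IsLittlewoodRichardson)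
    (hP : IsNormalFormOf InwardSlide P T) (hQ : IsNormalFormOf InwardSlide Q T) : P = Q := by
  have hPyoung := isNormal_inwardSlide_iff.1 hP.2
  have hQyoung := isNormal_inwardSlide_iff.1 hQ.2
  refine (hT.of_reflTransGen_inwardSlide hP.1).eq_of_card_level_eq hPyoung
    (hT.of_reflTransGen_inwardSlide hQ.1) hQyoung fun k => ?_
  have h1 := card_level_of_reflTransGen_inwardSlide hP.1 k
  have h2 := card_level_of_reflTransGen_inwardSlide hQ.1 k
  rw [show P.inner = ⊥ from hPyoung] at h1
  rw [show Q.inner = ⊥ from hQyoung] at h2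
  lia

theorem shape_of_reflTransGen_raisingStep (h : Relation.ReflTransGen RaisingStep T U) :
    U.outer = T.outer ∧ U.inner = T.inner := by
  induction h with
  | refl => exact ⟨rfl, rfl⟩
  | tail _ hraises ih =>
    obtain ⟨i, houter, hinner, -⟩ := hraises
    exact ⟨houter.trans ih.1, hinner.trans ih.2⟩

theorem IsYoung.raisingStep_unique (hT : T.IsYoung)
    (hP : IsNormalFormOf RaisingStep P T) (hQ : IsNormalFormOf RaisingStep Q T) : P = Q := by
  obtain ⟨hPouter, hPinner⟩ := shape_of_reflTransGen_raisingStep hP.1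
  obtain ⟨hQouter, hQinner⟩ := shape_of_reflTransGen_raisingStep hQ.1
  exact (isNormal_raisingStep_iff.1 hP.2).eq_of_outer_eq (hPinner.trans hT)
    (isNormal_raisingStep_iff.1 hQ.2) (hQinner.trans hT) (hPouter.trans hQouter.symm)

theorem Raises.isNormal_slideFrom (h : Raises i T U) (hT : IsNormal (Step SlideFrom) T) :
    IsNormal (Step SlideFrom) U := by
  rw [step_slideFrom, isNormal_inwardSlide_iff] at hT ⊢
  exact h.isYoung hT

theorem SlideFrom.isNormal_raises {x : ℕ × YoungDiagram} (h : SlideFrom x T U)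
    (hT : IsNormal RaisingStep T) : IsNormal RaisingStep U := by
  rw [isNormal_raisingStep_iff] at hT ⊢
  exact h.2.isLittlewoodRichardson hT

theorem isNormalFormOf_inwardSlide_unique (hP : IsNormalFormOf InwardSlide P T)
    (hQ : IsNormalFormOf InwardSlide Q T) : P = Q := by
  rw [← step_slideFrom] at hP hQ
  refine Diamond.isNormalFormOf_unique diamond_slideFrom_raises leftUnique_raises
    (fun _ _ _ => Raises.isNormal_slideFrom) (fun L _ _ hL hP hQ => ?_)
    exists_isNormalFormOf_raisingStep hP hQ
  rw [step_slideFrom] at hP hQ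
  exact (isNormal_raisingStep_iff.1 hL).inwardSlide_unique hP hQ

theorem isNormalFormOf_raisingStep_unique (hP : IsNormalFormOf RaisingStep P T)
    (hQ : IsNormalFormOf RaisingStep Q T) : P = Q := by
  refine Diamond.isNormalFormOf_unique (fun i x => (diamond_slideFrom_raises x i).symm)
    leftUnique_slideFrom (fun _ _ _ => SlideFrom.isNormal_raises) (fun P _ _ hP => ?_)
    (step_slideFrom ▸ exists_isNormalFormOf_inwardSlide) hP hQ
  rw [step_slideFrom, isNormal_inwardSlide_iff] at hP
  exact hP.raisingStep_unique

theorem eq_of_isNormalFormOf (hT : IsNormalFormOf InwardSlide P T)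
    (hT' : Relation.ReflTransGen RaisingStep T Q) (hU : IsNormalFormOf InwardSlide P U)
    (hU' : Relation.ReflTransGen RaisingStep U Q) : T = U := by
  rw [← step_slideFrom] at hT hU
  refine Diamond.eq_of_isNormalFormOf diamond_slideFrom_raises diamond_slideFrom_flip_raises
    leftUnique_slideFrom leftUnique_raises (fun _ _ _ => Raises.isNormal_slideFrom)
    (fun _ _ _ => ?_) hT hT' hU hU'
  rw [step_slideFrom]
  exact isNormalFormOf_inwardSlide_unique

end SkewSSYT

theorem mainTheorem3 :
    (Confluent SkewSSYT.InwardSlide ∧ Confluent SkewSSYT.RaisingStep) ∧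
    (∀ T : SkewSSYT, IsNormal SkewSSYT.InwardSlide T ↔ T.IsYoung) ∧
    (∀ T : SkewSSYT, IsNormal SkewSSYT.RaisingStep T ↔ T.IsLittlewoodRichardson) ∧
    (∀ T : SkewSSYT, ∃! P : SkewSSYT, IsNormalFormOf SkewSSYT.InwardSlide P T) ∧
    (∀ T : SkewSSYT, ∃! L : SkewSSYT, IsNormalFormOf SkewSSYT.RaisingStep L T) ∧
    (∀ T₁ T₂ P L : SkewSSYT,
      IsNormalFormOf SkewSSYT.InwardSlide P T₁ → IsNormalFormOf SkewSSYT.RaisingStep L T₁ →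
      IsNormalFormOf SkewSSYT.InwardSlide P T₂ → IsNormalFormOf SkewSSYT.RaisingStep L T₂ →
      T₁ = T₂) := by
  refine ⟨⟨?_, ?_⟩, ?_, ?_, fun T => ?_, fun T => ?_, ?_⟩
  · exact IsNormalFormOf.confluent SkewSSYT.exists_isNormalFormOf_inwardSlide
      fun _ _ _ => SkewSSYT.isNormalFormOf_inwardSlide_unique
  · exact IsNormalFormOf.confluent SkewSSYT.exists_isNormalFormOf_raisingStep
      fun _ _ _ => SkewSSYT.isNormalFormOf_raisingStep_unique
  · exact fun T => SkewSSYT.isNormal_inwardSlide_iff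
  · exact fun T => SkewSSYT.isNormal_raisingStep_iff
  · obtain ⟨P, hP⟩ := SkewSSYT.exists_isNormalFormOf_inwardSlide T
    exact ⟨P, hP, fun Q hQ => SkewSSYT.isNormalFormOf_inwardSlide_unique hQ hP⟩
  · obtain ⟨L, hL⟩ := SkewSSYT.exists_isNormalFormOf_raisingStep T
    exact ⟨L, hL, fun M hM => SkewSSYT.isNormalFormOf_raisingStep_unique hM hL⟩
  · exact fun T₁ T₂ P L hP₁ hL₁ hP₂ hL₂ =>
      SkewSSYT.eq_of_isNormalFormOf hP₁ hL₁.1 hP₂ hL₂.1
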